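/- Let $p\ge 2$ be an integer and let $k$ be a real number with $pk>1/2$. Identify $\mathbb R^2$ with $\mathbb C$, and let $\mathcal D_2(2p)$ be the dihedral group of order $4p$ generated by the reflections $\sigma_l$ in the lines orthogonal to the unit vectors $\alpha_l=-i\,e^{i\pi l/(2p)}$, $1\le l\le 2p$. Let $T_\xi f=\partial_\xi f+k\sum_{l=1}^{2p}\langle\alpha_l,\xi\rangle\,\frac{f-f\circ\sigma_l}{\langle\alpha_l,\cdot\rangle}$ be its Dunkl operators with constant multiplicity $k$, let $E_k(x,\cdot)$ be the Dunkl kernel, that is, the unique smooth function on $\mathbb R^2$ with $T_\xi E_k(x,\cdot)=\langle \xi,x\rangle E_k(x,\cdot)$ for all $\xi\in\mathbb R^2$ and $E_k(x,0)=1$, and let $D_k(x,y)=\frac1{4p}\sum_{w\in\mathcal D_2(2p)}E_k(x,wy)$ be the generalized Bessel function. Let $c_{2p,k}=B(k+\tfrac12,\tfrac12)\,\Gamma(2pk+1)/k$, where $B$ is the Beta function. For $u=(u_1,\dots,u_{p-1})$ put $u_0=1-u_1-\dots-u_{p-1}$ and let $\Sigma_p=\{u: u_0,u_1,\dots,u_{p-1}\ge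 0\}$. With $A_s=\cos(2s\pi/p)$ and $B_s=-\sin(2s\pi/p)$ let $$a(u)=\sqrt{1+u_0+\sum_{s=1}^{p-1}u_sA_s},\qquad b(u)=\frac1{a(u)}\sum_{s=1}^{p-1}u_sB_s,$$ $$c(u)=\frac1{a(u)}\sqrt{1-\Bigl(u_0+\sum_{s=1}^{p-1}u_sA_s\Bigr)^2-\Bigl(\sum_{s=1}^{p-1}u_sB_s\Bigr)^2}$$ (defined for almost every $u\in\Sigma_p$). Then, for every $\rho>0$ and every $y=re^{i\theta}$ with $r\ge0$, $0\le\theta\le\pi/(2p)$, $$D_k(\rho,y)=\int_{\mathbb R^2}e^{\langle y,z\rangle}H_p(\rho,z)\,dz,$$ where the integral converges absolutely and $$H_p(\rho,z)=\frac{pk-\frac12}{\pi}\cdot\frac{c_{2p,k}\,\Gamma(pk)}{2p\,B(k+\frac12,\frac12)\,\Gamma(2pk)\,\Gamma(k)^p}\int_{E_{z,\rho,p}}a(u)c(u)\Bigl(\frac{2}{\rho^2a(u)^2c(u)^2}\Bigr)^{pk-\frac12}\Bigl(\frac{\rho^2a(u)^2c(u)^2}{2}-(c(u)z_1)^2-(a(u)z_2-b(u)z_1)^2\Bigr)^{pk-\frac32}u_0^{k-1}\prod_{s=1}^{p-1}u_s^{k-1}\,du_1\cdots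 du_{p-1},$$ $$E_{z,\rho,p}=\Bigl\{u\in\Sigma_p:\ \frac{\rho^2a(u)^2c(u)^2}{2}>(c(u)z_1)^2+(a(u)z_2-b(u)z_1)^2\Bigr\},$$ the integral defining $H_p(\rho,z)$ being absolutely convergent for almost every $z\in\mathbb R^2$. -/

import Mathlib

open MeasureTheory
open scoped ContDiff

noncomputable section

/-- The positive roots `-i e^{iπl/n}`, `1 ≤ l ≤ n`, of the dihedral root system `I₂(n)`, here indexed
by `j = l - 1 ∈ {0, …, n-1}`; the Euclidean plane is `ℂ` with its real inner product. -/
def dihedralRoot (n j : ℕ) : ℂ :=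
  -Complex.I * Complex.exp (Complex.I * (Real.pi * ((j : ℝ) + 1) / n : ℝ))

/-- The orthogonal reflection `σ_α` in the line orthogonal to `α`. -/
def rootReflection (α y : ℂ) : ℂ :=
  y - (2 * inner ℝ α y / inner ℝ α α : ℝ) • α

open Classical in
/-- The difference quotient `(f(y) - f(σ_α y)) / ⟨α, y⟩`, extended to the line `⟨α, y⟩ = 0` by its
limit `(2 / ⟨α, α⟩) ∂_α f(y)`. -/
def reflectionQuotient (α : ℂ) (f : ℂ → ℝ) (y : ℂ) : ℝ :=
  if inner ℝ α y = 0 then 2 / inner ℝ α α * fderiv ℝ f y α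
  else (f y - f (rootReflection α y)) / inner ℝ α y

/-- The Dunkl operator
`T_ξ f = ∂_ξ f + k ∑_{α > 0} ⟨α, ξ⟩ (f - f ∘ σ_α) / ⟨α, ·⟩`
of the dihedral group `D₂(n)` with constant multiplicity function `k`. -/
def dunklOperator (n : ℕ) (k : ℝ) (ξ : ℂ) (f : ℂ → ℝ) (y : ℂ) : ℝ :=
  fderiv ℝ f y ξ +
    k * ∑ j ∈ Finset.range n,
      inner ℝ (dihedralRoot n j) ξ * reflectionQuotient (dihedralRoot n j) f y

/-- The joint eigenvalue problem `T_ξ f = ⟨ξ, x⟩ f` for all `ξ`, normalized by `f(0) = 1`. -/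
structure IsDunklEigenfunction (n : ℕ) (k : ℝ) (x : ℂ) (f : ℂ → ℝ) : Prop where
  smooth : ContDiff ℝ ∞ f
  map_zero : f 0 = 1
  eigen : ∀ ξ y : ℂ, dunklOperator n k ξ f y = inner ℝ ξ x * f y

/-- The Dunkl kernel `E_k(x, y)` of `D₂(n)`: for `k ≥ 0` and each `x`, the function `y ↦ E_k(x, y)` is
the unique normalized joint eigenfunction of the Dunkl operators with spectral parameter `x`. -/
def dunklKernel (n : ℕ) (k : ℝ) (x : ℂ) : ℂ → ℝ :=
  Classical.epsilon (IsDunklEigenfunction n k x)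

/-- The rotation by the angle `2πj/n`. -/
def dihedralRotation (n j : ℕ) (y : ℂ) : ℂ :=
  Complex.exp (Complex.I * (2 * Real.pi * j / n : ℝ)) * y

/-- The generalized Bessel function `D_k(x, y) = |W|⁻¹ ∑_{w ∈ W} E_k(x, w y)` of `W = D₂(n)`. The `2n`
elements of `W` are the rotations by `2πj/n`, `0 ≤ j < n`, and their compositions with complex
conjugation, which is the reflection fixing the line of angle `0`. -/
def generalizedBessel (n : ℕ) (k : ℝ) (x y : ℂ) : ℝ :=
  1 / (2 * n) * ∑ j ∈ Finset.range n,
    (dunklKernel n k x (dihedralRotation n j y) +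
      dunklKernel n k x (dihedralRotation n j (starRingEnd ℂ y)))

/-- The closed Weyl chamber `{r e^{iθ} : r ≥ 0, 0 ≤ θ ≤ π/n}` of `D₂(n)`. -/
def closedWeylChamber (n : ℕ) : Set ℂ :=
  {y | ∃ r θ : ℝ, 0 ≤ r ∧ 0 ≤ θ ∧ θ ≤ Real.pi / n ∧ y = r * Complex.exp (Complex.I * θ)}

/-- The constant `c_{n,k}` in the expansion
`D_k(ρe^{iφ}, re^{iθ}) = c_{n,k} / B(k+1/2, 1/2) ∑_{j,m ≥ 0} (j+k) / (m! Γ(n(j+k)+m+1))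
  C_j^{(k)}(cos nφ) C_j^{(k)}(cos nθ) / C_j^{(k)}(1) (ρr/2)^{2m+nj}`,
determined by `D_k(0, y) = 1`, where only the term `j = m = 0` contributes; that is,
`c_{n,k} / B(k+1/2, 1/2) * (k / Γ(nk+1)) = 1`. -/
def besselConstant (n : ℕ) (k : ℝ) : ℝ :=
  ProbabilityTheory.beta (k + 1 / 2) (1 / 2) * Real.Gamma (n * k + 1) / k

/-! Coordinates on the simplex `Σ_p`: the variables `u_1, …, u_{p-1}` are `u i` with `s = i + 1`. -/

/-- `u_0 = 1 - u_1 - ⋯ - u_{p-1}`. -/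
def simplexZero {p : ℕ} (u : Fin (p - 1) → ℝ) : ℝ :=
  1 - ∑ i, u i

/-- The standard simplex `Σ_p`, in the coordinates `u_1, …, u_{p-1}`. -/
def stdSimplexCoord (p : ℕ) : Set (Fin (p - 1) → ℝ) :=
  {u | 0 ≤ simplexZero u ∧ ∀ i, 0 ≤ u i}

/-- `∑_{s=1}^{p-1} u_s A_s` with `A_s = cos(2sπ/p)`. -/
def sumA {p : ℕ} (u : Fin (p - 1) → ℝ) : ℝ :=
  ∑ i, u i * Real.cos (2 * ((i : ℝ) + 1) * Real.pi / p)

/-- `∑_{s=1}^{p-1} u_s B_s` with `B_s = -sin(2sπ/p)`. -/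
def sumB {p : ℕ} (u : Fin (p - 1) → ℝ) : ℝ :=
  ∑ i, u i * -Real.sin (2 * ((i : ℝ) + 1) * Real.pi / p)

def coeffA {p : ℕ} (u : Fin (p - 1) → ℝ) : ℝ :=
  Real.sqrt (1 + simplexZero u + sumA u)

def coeffB {p : ℕ} (u : Fin (p - 1) → ℝ) : ℝ :=
  1 / coeffA u * sumB u

def coeffC {p : ℕ} (u : Fin (p - 1) → ℝ) : ℝ :=
  1 / coeffA u * Real.sqrt (1 - (simplexZero u + sumA u) ^ 2 - sumB u ^ 2)

/-- The set `E_{z,ρ,p}`. -/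
def laplaceRegion (p : ℕ) (ρ : ℝ) (z : ℂ) : Set (Fin (p - 1) → ℝ) :=
  {u | u ∈ stdSimplexCoord p ∧
    (coeffC u * z.re) ^ 2 + (coeffA u * z.im - coeffB u * z.re) ^ 2 <
      ρ ^ 2 * coeffA u ^ 2 * coeffC u ^ 2 / 2}

/-- The integrand in the definition of `H_p(ρ, z)`. -/
def laplaceIntegrand (p : ℕ) (k ρ : ℝ) (z : ℂ) (u : Fin (p - 1) → ℝ) : ℝ :=
  coeffA u * coeffC u *
    (2 / (ρ ^ 2 * coeffA u ^ 2 * coeffC u ^ 2)) ^ ((p : ℝ) * k - 1 / 2) *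
    (ρ ^ 2 * coeffA u ^ 2 * coeffC u ^ 2 / 2 - (coeffC u * z.re) ^ 2 -
      (coeffA u * z.im - coeffB u * z.re) ^ 2) ^ ((p : ℝ) * k - 3 / 2) *
    (simplexZero u ^ (k - 1) * ∏ i, u i ^ (k - 1))

/-- The kernel `H_p(ρ, z)`. The factor `(pk - 1/2) / π` normalizes the measure
`(1 - |z|²)^{pk - 3/2} dz` on the unit disc to total mass one. -/
def laplaceKernel (p : ℕ) (k ρ : ℝ) (z : ℂ) : ℝ :=
  ((p : ℝ) * k - 1 / 2) / Real.pi *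
    (besselConstant (2 * p) k * Real.Gamma (p * k) /
      (2 * p * ProbabilityTheory.beta (k + 1 / 2) (1 / 2) * Real.Gamma (2 * p * k) * Real.Gamma k ^ p)) *
    ∫ u in laplaceRegion p ρ z, laplaceIntegrand p k ρ z u

end

noncomputable section

open Polynomial in
theorem image_pow_range_eq_nthRootsFinset {n : ℕ} {ζ : ℂ} (hζ : IsPrimitiveRoot ζ n) (hn : 0 < n) :
    (Finset.range n).image (fun j => ζ ^ j) = nthRootsFinset n (1 : ℂ) := by
  classical
  apply Finset.eq_of_subset_of_card_le
  · intro τ hτ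
    obtain ⟨j, -, rfl⟩ := Finset.mem_image.1 hτ
    rw [mem_nthRootsFinset hn, ← pow_mul, mul_comm, pow_mul, hζ.pow_eq_one, one_pow]
  · rw [hζ.card_nthRootsFinset, Finset.card_image_of_injOn, Finset.card_range]
    intro i hi j hj h
    exact hζ.pow_inj (by simpa using hi) (by simpa using hj) h

open Polynomial in
@[to_additive sum_range_pow_eq_sum_nthRootsFinset]
theorem prod_range_pow_eq_prod_nthRootsFinset {M : Type*} [CommMonoid M] {n : ℕ} {ζ : ℂ}
    (hζ : IsPrimitiveRoot ζ n) (hn : 0 < n) (g : ℂ → M) :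
    ∏ j ∈ Finset.range n, g (ζ ^ j) = ∏ τ ∈ nthRootsFinset n (1 : ℂ), g τ := by
  classical
  rw [← image_pow_range_eq_nthRootsFinset hζ hn, Finset.prod_image]
  intro i hi j hj h
  exact hζ.pow_inj (by simpa using hi) (by simpa using hj) h

open Polynomial in
@[to_additive sum_nthRootsFinset_mul]
theorem prod_nthRootsFinset_mul {M : Type*} [CommMonoid M] {n : ℕ} (hn : 0 < n) {η : ℂ}
    (hη : η ^ n = 1) (g : ℂ → M) :
    ∏ τ ∈ nthRootsFinset n (1 : ℂ), g (η * τ) = ∏ τ ∈ nthRootsFinset n (1 : ℂ), g τ := by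
  have h0 : η ≠ 0 := by
    rintro rfl
    simp [zero_pow hn.ne'] at hη
  apply Finset.prod_nbij' (fun τ => η * τ) (fun τ => η⁻¹ * τ)
  · intro τ hτ
    rw [mem_nthRootsFinset hn] at *
    rw [mul_pow, hη, hτ, one_mul]
  · intro τ hτ
    rw [mem_nthRootsFinset hn] at *
    rw [mul_pow, inv_pow, hη, hτ, inv_one, one_mul]
  · intro τ _
    simp [h0]
  · intro τ _
    simp [h0]
  · intro τ _
    rfl

theorem norm_eq_one_of_mem_nthRootsFinset {n : ℕ} (hn : 0 < n) {τ : ℂ}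
    (hτ : τ ∈ Polynomial.nthRootsFinset n (1 : ℂ)) : ‖τ‖ = 1 := by
  rw [Polynomial.mem_nthRootsFinset hn] at hτ
  exact Complex.norm_eq_one_of_pow_eq_one hτ hn.ne'

theorem norm_dihedralRoot (n j : ℕ) : ‖dihedralRoot n j‖ = 1 := by
  unfold dihedralRoot
  rw [norm_mul, mul_comm Complex.I, Complex.norm_exp_ofReal_mul_I]
  simp

theorem inner_dihedralRoot_self (n j : ℕ) :
    inner ℝ (dihedralRoot n j) (dihedralRoot n j) = (1 : ℝ) := by
  rw [real_inner_self_eq_norm_sq, norm_dihedralRoot, one_pow]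

theorem rootReflection_of_norm_eq_one {α : ℂ} (hα : ‖α‖ = 1) (z : ℂ) :
    rootReflection α z = -α ^ 2 * starRingEnd ℂ z := by
  have h1 : inner ℝ α α = (1 : ℝ) := by rw [real_inner_self_eq_norm_sq, hα, one_pow]
  have h2 : α * starRingEnd ℂ α = 1 := by
    rw [Complex.mul_conj, Complex.normSq_eq_norm_sq, hα]; simp
  have h3 : ((2 * inner ℝ α z : ℝ) : ℂ) =
      starRingEnd ℂ α * z + α * starRingEnd ℂ z := by
    rw [Complex.inner]
    apply Complex.ext <;> simp <;> ring
  unfold rootReflection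
  rw [h1, div_one, ← Complex.coe_smul, h3, smul_eq_mul]
  linear_combination (-z) * h2

theorem rootReflection_dihedralRoot (n j : ℕ) (z : ℂ) :
    rootReflection (dihedralRoot n j) z =
      Complex.exp (2 * Real.pi * Complex.I / n) * Complex.exp (2 * Real.pi * Complex.I / n) ^ j *
        starRingEnd ℂ z := by
  rw [rootReflection_of_norm_eq_one (norm_dihedralRoot n j), ← pow_succ', ← Complex.exp_nat_mul]
  congr 1
  unfold dihedralRoot
  rw [mul_pow, ← Complex.exp_nat_mul, neg_sq, Complex.I_sq]
  simp only [neg_mul, one_mul, neg_neg]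
  congr 1
  push_cast
  ring

open Polynomial in
theorem sum_rootReflection {n : ℕ} (hn : 0 < n) (g : ℂ → ℝ) (z : ℂ) :
    ∑ j ∈ Finset.range n, g (rootReflection (dihedralRoot n j) z) =
      ∑ τ ∈ nthRootsFinset n (1 : ℂ), g (τ * starRingEnd ℂ z) := by
  simp_rw [rootReflection_dihedralRoot]
  have hζ := Complex.isPrimitiveRoot_exp n hn.ne'
  rw [← sum_nthRootsFinset_mul hn hζ.pow_eq_one, ← sum_range_pow_eq_sum_nthRootsFinset hζ hn]

theorem inner_mul_reflectionQuotient {α : ℂ} (f : ℂ → ℝ) (y : ℂ) :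
    inner ℝ α y * reflectionQuotient α f y = f y - f (rootReflection α y) := by
  unfold reflectionQuotient
  split_ifs with h
  · simp [rootReflection, h]
  · field_simp

theorem IsDunklEigenfunction.fderiv_self {n : ℕ} (hn : 0 < n) {k : ℝ} {x : ℂ} {f : ℂ → ℝ}
    (hf : IsDunklEigenfunction n k x f) (z : ℂ) :
    fderiv ℝ f z z + k * ∑ τ ∈ Polynomial.nthRootsFinset n (1 : ℂ),
      (f z - f (τ * starRingEnd ℂ z)) = inner ℝ z x * f z := by
  rw [← hf.eigen z z, ← sum_rootReflection hn (fun w => f z - f w)]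
  unfold dunklOperator
  simp_rw [inner_mul_reflectionQuotient]

open Polynomial in
/-- A differentiable function which vanishes at the origin and satisfies the radial part of the Dunkl
eigenvalue equations is zero: along rays its mean square over the group satisfies a Gronwall
inequality. -/
theorem eq_zero_of_radial_equation {n : ℕ} (hn : 0 < n) {k : ℝ} (hk : 0 ≤ k) (x : ℂ) {h : ℂ → ℝ}
    (hd : Differentiable ℝ h) (h0 : h 0 = 0)
    (hr : ∀ z, fderiv ℝ h z z + k * ∑ τ ∈ nthRootsFinset n (1 : ℂ),
      (h z - h (τ * starRingEnd ℂ z)) = inner ℝ z x * h z) (y : ℂ) : h y = 0 := by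
  set R := nthRootsFinset n (1 : ℂ) with hR
  have hline : ∀ (v : ℂ) (t : ℝ), HasDerivAt (fun s : ℝ => h (s • v)) (fderiv ℝ h (t • v) v) t := by
    intro v t
    have h1 : HasDerivAt (fun s : ℝ => s • v) v t := by
      simpa using (hasDerivAt_id t).smul_const v
    exact (hd (t • v)).hasFDerivAt.comp_hasDerivAt t h1
  set K := ‖x‖ * ‖y‖ with hK
  set S : ℝ → ℝ := fun t =>
    ∑ τ ∈ R, (h (t • (τ * y)) ^ 2 + h (t • (τ * starRingEnd ℂ y)) ^ 2) with hS
  set S' : ℝ → ℝ := fun t =>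
    ∑ τ ∈ R, (2 * h (t • (τ * y)) * fderiv ℝ h (t • (τ * y)) (τ * y) +
      2 * h (t • (τ * starRingEnd ℂ y)) *
        fderiv ℝ h (t • (τ * starRingEnd ℂ y)) (τ * starRingEnd ℂ y)) with hS'
  have hSd : ∀ t, HasDerivAt S (S' t) t := by
    intro t
    apply HasDerivAt.fun_sum
    intro τ _
    apply HasDerivAt.add
    · simpa using (hline (τ * y) t).fun_pow 2
    · simpa using (hline (τ * starRingEnd ℂ y) t).fun_pow 2
  have radial : ∀ (v : ℂ) (t : ℝ) (τ : ℂ), τ ∈ R → t * fderiv ℝ h (t • (τ * v)) (τ * v) =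
      t * inner ℝ (τ * v) x * h (t • (τ * v)) - k * (R.card * h (t • (τ * v)) -
        ∑ η ∈ R, h (t • (η * starRingEnd ℂ v))) := by
    intro v t τ hτ
    have h1 := hr (t • (τ * v))
    have hτ' := (mem_nthRootsFinset hn 1).1 hτ
    have h2 : ∑ η ∈ R, h (η * starRingEnd ℂ (t • (τ * v))) =
        ∑ η ∈ R, h (t • (η * starRingEnd ℂ v)) := by
      rw [← sum_nthRootsFinset_mul hn (η := starRingEnd ℂ τ) (by rw [← map_pow, hτ', map_one])
        (fun η => h (t • (η * starRingEnd ℂ v)))]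
      apply Finset.sum_congr rfl
      intro η _
      congr 1
      simp only [Complex.real_smul, map_mul, Complex.conj_ofReal]
      ring
    rw [Finset.sum_sub_distrib, h2, Finset.sum_const, nsmul_eq_mul, map_smul, smul_eq_mul,
      real_inner_smul_left] at h1
    linarith
  have hbound : ∀ (v : ℂ), ‖v‖ = ‖y‖ → ∀ τ ∈ R, inner ℝ (τ * v) x ≤ K := by
    intro v hv τ hτ
    refine (real_inner_le_norm _ _).trans ?_
    rw [norm_mul, norm_eq_one_of_mem_nthRootsFinset hn hτ, hv, hK]
    linarith
  have hineq : ∀ t, 0 < t → S' t ≤ 2 * K * S t := by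
    intro t ht
    have hA := radial y t
    have hC := radial (starRingEnd ℂ y) t
    rw [Complex.conj_conj] at hC
    set A : ℂ → ℝ := fun τ => h (t • (τ * y)) with hAdef
    set C : ℂ → ℝ := fun τ => h (t • (τ * starRingEnd ℂ y)) with hCdef
    have e : t * S' t = 2 * t * ∑ τ ∈ R, (inner ℝ (τ * y) x * A τ ^ 2 +
        inner ℝ (τ * starRingEnd ℂ y) x * C τ ^ 2) - 2 * k * (R.card * (∑ τ ∈ R, A τ ^ 2) +
          R.card * (∑ τ ∈ R, C τ ^ 2) - 2 * (∑ τ ∈ R, A τ) * (∑ τ ∈ R, C τ)) := by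
      have e1 : t * S' t = ∑ τ ∈ R, (2 * t * (inner ℝ (τ * y) x * A τ ^ 2 +
          inner ℝ (τ * starRingEnd ℂ y) x * C τ ^ 2) - 2 * k * (R.card * A τ ^ 2 +
            R.card * C τ ^ 2 - A τ * (∑ η ∈ R, C η) - C τ * (∑ η ∈ R, A η))) := by
        rw [hS', Finset.mul_sum]
        apply Finset.sum_congr rfl
        intro τ hτ
        linear_combination 2 * A τ * hA τ hτ + 2 * C τ * hC τ hτ
      rw [e1, Finset.sum_sub_distrib, ← Finset.mul_sum, ← Finset.mul_sum, Finset.sum_sub_distrib,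
        Finset.sum_sub_distrib, ← Finset.sum_mul, ← Finset.sum_mul, Finset.sum_add_distrib,
        Finset.sum_add_distrib, ← Finset.mul_sum, ← Finset.mul_sum]
      ring
    have c1 := sq_sum_le_card_mul_sum_sq (s := R) (f := A)
    have c2 := sq_sum_le_card_mul_sum_sq (s := R) (f := C)
    have c3 : 0 ≤ R.card * (∑ τ ∈ R, A τ ^ 2) +
          R.card * (∑ τ ∈ R, C τ ^ 2) - 2 * (∑ τ ∈ R, A τ) * (∑ τ ∈ R, C τ) := by
      nlinarith [sq_nonneg ((∑ τ ∈ R, A τ) - ∑ τ ∈ R, C τ)]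
    have c4 : ∑ τ ∈ R, (inner ℝ (τ * y) x * A τ ^ 2 +
        inner ℝ (τ * starRingEnd ℂ y) x * C τ ^ 2) ≤ K * S t := by
      rw [hS, Finset.mul_sum]
      apply Finset.sum_le_sum
      intro τ hτ
      have := mul_le_mul_of_nonneg_right (hbound y rfl τ hτ) (sq_nonneg (A τ))
      have := mul_le_mul_of_nonneg_right (hbound (starRingEnd ℂ y) (by simp) τ hτ)
        (sq_nonneg (C τ))
      simp only [hAdef, hCdef] at *
      linarith
    have c5 : t * S' t ≤ t * (2 * K * S t) := by
      rw [e]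
      have := mul_le_mul_of_nonneg_left c4 ht.le
      have := mul_nonneg hk c3
      linarith
    exact le_of_mul_le_mul_left c5 ht
  have hg : ∀ t, HasDerivAt (fun t => Real.exp (-(2 * K) * t) * S t)
      (Real.exp (-(2 * K) * t) * (-(2 * K)) * S t + Real.exp (-(2 * K) * t) * S' t) t := by
    intro t
    apply HasDerivAt.mul _ (hSd t)
    have := ((hasDerivAt_id t).const_mul (-(2 * K))).exp
    simpa using this
  have hanti : AntitoneOn (fun t => Real.exp (-(2 * K) * t) * S t) (Set.Ici 0) := by
    apply antitoneOn_of_deriv_nonpos (convex_Ici 0)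
    · exact fun t _ => (hg t).continuousAt.continuousWithinAt
    · exact fun t _ => (hg t).differentiableAt.differentiableWithinAt
    · intro t ht
      rw [interior_Ici] at ht
      rw [(hg t).deriv]
      have := mul_le_mul_of_nonneg_left (hineq t ht) (Real.exp_pos (-(2 * K) * t)).le
      linarith
  have hS0 : S 0 = 0 := by simp [hS, h0]
  have h1 := hanti (Set.mem_Ici.2 le_rfl) (Set.mem_Ici.2 zero_le_one) zero_le_one
  simp only [hS0, mul_zero, mul_one] at h1
  have hS1 : S 1 ≤ 0 := by
    by_contra hcon
    push Not at hcon
    exact absurd h1 (not_le.2 (mul_pos (Real.exp_pos _) hcon))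
  have hone : (1 : ℂ) ∈ R := one_mem_nthRootsFinset hn
  have h2 : h y ^ 2 + h (starRingEnd ℂ y) ^ 2 ≤ S 1 := by
    have := Finset.single_le_sum
      (f := fun τ => h ((1 : ℝ) • (τ * y)) ^ 2 + h ((1 : ℝ) • (τ * starRingEnd ℂ y)) ^ 2)
      (fun τ _ => by positivity) hone
    simpa [hS] using this
  nlinarith [sq_nonneg (h (starRingEnd ℂ y))]

/-- A normalized joint eigenfunction of the Dunkl operators is unique. -/
theorem IsDunklEigenfunction.unique {n : ℕ} (hn : 0 < n) {k : ℝ} (hk : 0 ≤ k) {x : ℂ} {f g : ℂ → ℝ}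
    (hf : IsDunklEigenfunction n k x f) (hg : IsDunklEigenfunction n k x g) : f = g := by
  have hfd := hf.smooth.differentiable (by simp)
  have hgd := hg.smooth.differentiable (by simp)
  funext y
  rw [← sub_eq_zero]
  refine eq_zero_of_radial_equation hn hk x (h := fun y => f y - g y) (hfd.sub hgd)
    (by rw [hf.map_zero, hg.map_zero, sub_self]) (fun z => ?_) y
  have h1 := hf.fderiv_self hn z
  have h2 := hg.fderiv_self hn z
  rw [fderiv_fun_sub (hfd z) (hgd z), sub_apply]
  simp only [Finset.sum_sub_distrib] at *
  linarith

end

noncomputable section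

open PowerSeries

/-- The Pochhammer symbol `(b)_m = b (b + 1) ⋯ (b + m - 1)`. -/
def poch (b : ℝ) (m : ℕ) : ℝ := (ascPochhammer ℝ m).eval b

theorem poch_zero (b : ℝ) : poch b 0 = 1 := by simp [poch]

theorem poch_succ (b : ℝ) (m : ℕ) : poch b (m + 1) = poch b m * (b + m) := by
  simp [poch, ascPochhammer_succ_eval]

theorem poch_succ_left (b : ℝ) (m : ℕ) : poch b (m + 1) = b * poch (b + 1) m := by
  simp [poch, ascPochhammer_succ_left, Polynomial.eval_comp]

theorem poch_pos {b : ℝ} (hb : 0 < b) (m : ℕ) : 0 < poch b m := ascPochhammer_pos m b hb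

theorem poch_nonneg {b : ℝ} (hb : 0 ≤ b) (m : ℕ) : 0 ≤ poch b m := by
  induction m with
  | zero => simp [poch_zero]
  | succ m ih => rw [poch_succ]; positivity

theorem poch_zero_succ (m : ℕ) : poch 0 (m + 1) = 0 := by simp [poch_succ_left]

/-- The binomial series `(1 - a X)^{-b}`. -/
def negBinomial (b a : ℝ) : ℝ⟦X⟧ := PowerSeries.mk fun m => poch b m / m.factorial * a ^ m

theorem coeff_negBinomial (b a : ℝ) (m : ℕ) :
    coeff m (negBinomial b a) = poch b m / m.factorial * a ^ m := by
  simp [negBinomial]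

theorem negBinomial_zero (a : ℝ) : negBinomial 0 a = 1 := by
  ext m
  rw [coeff_negBinomial, coeff_one]
  cases m with
  | zero => simp [poch_zero]
  | succ m => simp [poch_zero_succ]

theorem one_sub_mul_negBinomial (b a : ℝ) :
    (1 - C a * X) * negBinomial (b + 1) a = negBinomial b a := by
  ext m
  rw [sub_mul, one_mul, map_sub, mul_assoc, coeff_C_mul]
  cases m with
  | zero => simp [coeff_negBinomial, poch_zero]
  | succ m =>
    rw [coeff_succ_X_mul, coeff_negBinomial, coeff_negBinomial, coeff_negBinomial, poch_succ,
      poch_succ_left, Nat.factorial_succ]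
    push_cast
    field_simp
    ring

theorem negBinomial_succ (b a : ℝ) :
    negBinomial (b + 1) a = negBinomial b a * negBinomial 1 a := by
  have h1 := one_sub_mul_negBinomial 0 a
  rw [zero_add, negBinomial_zero] at h1
  linear_combination (-negBinomial (b + 1) a) * h1 +
    negBinomial 1 a * one_sub_mul_negBinomial b a

theorem derivative_negBinomial (b a : ℝ) :
    d⁄dX ℝ (negBinomial b a) = C (b * a) * negBinomial 1 a * negBinomial b a := by
  rw [mul_assoc, mul_comm (negBinomial 1 a), ← negBinomial_succ]
  ext m
  rw [coeff_derivative, coeff_C_mul, coeff_negBinomial, coeff_negBinomial, poch_succ_left,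
    Nat.factorial_succ]
  push_cast
  field_simp
  ring

theorem eq_of_derivative_eq_mul {F H g : ℝ⟦X⟧} (hF : d⁄dX ℝ F = g * F) (hH : d⁄dX ℝ H = g * H)
    (h0 : coeff 0 F = coeff 0 H) : F = H := by
  ext m
  induction m using Nat.strong_induction_on with
  | _ m ih =>
    cases m with
    | zero => exact h0
    | succ m =>
      have h1 := congrArg (coeff m) hF
      have h2 := congrArg (coeff m) hH
      rw [coeff_derivative, coeff_mul] at h1 h2
      have h3 : (coeff (m + 1) F) * ((m : ℝ) + 1) = (coeff (m + 1) H) * ((m : ℝ) + 1) := by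
        rw [h1, h2]
        apply Finset.sum_congr rfl
        intro q hq
        rw [ih q.2 (by have := Finset.HasAntidiagonal.mem_antidiagonal.1 hq; omega)]
      exact mul_right_cancel₀ (by positivity) h3

theorem negBinomial_add (b c a : ℝ) :
    negBinomial (b + c) a = negBinomial b a * negBinomial c a := by
  apply eq_of_derivative_eq_mul (g := C ((b + c) * a) * negBinomial 1 a)
  · rw [derivative_negBinomial]
  · rw [Derivation.leibniz, derivative_negBinomial, derivative_negBinomial,
      smul_eq_mul, smul_eq_mul, add_mul, map_add]
    ring
  · rw [coeff_mul]
    simp [coeff_negBinomial, poch_zero, -coeff_zero_eq_constantCoeff]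

theorem prod_negBinomial {ι : Type*} (s : Finset ι) (b : ι → ℝ) (a : ℝ) :
    ∏ i ∈ s, negBinomial (b i) a = negBinomial (∑ i ∈ s, b i) a := by
  classical
  induction s using Finset.induction_on with
  | empty => simp [negBinomial_zero]
  | insert i s hi ih => rw [Finset.prod_insert hi, Finset.sum_insert hi, ih, negBinomial_add]

theorem negBinomial_mul_negBinomial_neg (b a : ℝ) :
    negBinomial b a * negBinomial b (-a) = expand 2 two_ne_zero (negBinomial b (a ^ 2)) := by
  have g1 := one_sub_mul_negBinomial 0 a
  have g2 := one_sub_mul_negBinomial 0 (-a)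
  rw [zero_add, negBinomial_zero] at g1 g2
  rw [map_neg] at g2
  apply eq_of_derivative_eq_mul (g := C (b * a) * (negBinomial 1 a - negBinomial 1 (-a)))
  · rw [Derivation.leibniz, derivative_negBinomial, derivative_negBinomial, smul_eq_mul, smul_eq_mul, mul_neg, map_neg]
    ring
  · have key : (1 - C (a ^ 2) * X ^ 2) * d⁄dX ℝ (expand 2 two_ne_zero (negBinomial b (a ^ 2))) =
        C (2 * b * a ^ 2) * X * expand 2 two_ne_zero (negBinomial b (a ^ 2)) := by
      ext m
      rw [sub_mul, one_mul, map_sub, mul_assoc, mul_assoc, coeff_C_mul, coeff_C_mul,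
        coeff_derivative]
      rcases m with _ | m
      · simp [coeff_zero_eq_constantCoeff_apply, coeff_expand_of_not_dvd 2 two_ne_zero _
          (show ¬ 2 ∣ 1 by norm_num)]
      rw [coeff_succ_X_mul, pow_two X, mul_assoc, coeff_succ_X_mul]
      rcases Nat.even_or_odd' m with ⟨j, rfl | rfl⟩
      · rw [show 2 * j + 1 + 1 = 2 * (j + 1) by ring, coeff_expand_mul, coeff_expand_mul]
        rcases j with _ | j
        · simp [coeff_negBinomial, poch_zero, poch_succ]
          ring
        rw [show 2 * (j + 1) = 2 * j + 1 + 1 by ring, coeff_succ_X_mul, coeff_derivative,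
          show 2 * j + 1 + 1 = 2 * (j + 1) by ring, coeff_expand_mul, coeff_negBinomial,
          coeff_negBinomial, poch_succ _ (j + 1), Nat.factorial_succ (j + 1)]
        push_cast
        field_simp
        ring
      · rw [coeff_succ_X_mul, coeff_derivative,
          coeff_expand_of_not_dvd 2 two_ne_zero _ (show ¬ 2 ∣ 2 * j + 1 + 1 + 1 by omega),
          coeff_expand_of_not_dvd 2 two_ne_zero _ (show ¬ 2 ∣ 2 * j + 1 by omega)]
        simp
    have e1 : (1 : ℝ⟦X⟧) - C (a ^ 2) * X ^ 2 = (1 - C a * X) * (1 - -C a * X) := by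
      rw [map_pow]; ring
    have e2 : C (2 * b * a ^ 2) = 2 * C (b * a) * C a := by
      rw [show (2 : ℝ⟦X⟧) = C 2 from (map_ofNat C 2).symm, ← map_mul, ← map_mul]
      congr 1
      ring
    rw [e1, e2] at key
    set D := d⁄dX ℝ (expand 2 two_ne_zero (negBinomial b (a ^ 2)))
    set H := expand 2 two_ne_zero (negBinomial b (a ^ 2))
    set p := negBinomial 1 a
    set q := negBinomial 1 (-a)
    have e3 : D = (1 - C a * X) * p * ((1 - -C a * X) * q) * D := by rw [g1, g2]; ring
    have e4 : p - q = 2 * C a * X * p * q := by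
      linear_combination (-p) * g2 + q * g1
    rw [e3, e4]
    linear_combination p * q * key
  · have : coeff 0 (expand 2 two_ne_zero (negBinomial b (a ^ 2))) =
        coeff 0 (negBinomial b (a ^ 2)) := by
      simp
    rw [this, coeff_mul]
    simp [coeff_negBinomial, poch_zero, -coeff_zero_eq_constantCoeff]

end

noncomputable section

open PowerSeries

section Lauricella

section LogDeriv

variable {E : Type*} [NormedAddCommGroup E] [NormedSpace ℝ E]

/-- The coefficients of the power-series-valued function `F` are differentiable at `a`, and the
derivative in the direction `ξ` is the power series `F a * g ξ`. -/
def HasLogFDeriv (F : E → ℝ⟦X⟧) (g : E → ℝ⟦X⟧) (a : E) : Prop :=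
  ∀ N, ∃ L : E →L[ℝ] ℝ, HasFDerivAt (fun x => coeff N (F x)) L a ∧ ∀ ξ, L ξ = coeff N (F a * g ξ)

theorem HasLogFDeriv.mul {F G g h : E → ℝ⟦X⟧} {a : E} (hF : HasLogFDeriv F g a)
    (hG : HasLogFDeriv G h a) :
    HasLogFDeriv (fun x => F x * G x) (fun ξ => g ξ + h ξ) a := by
  intro N
  choose L hL hL' using hF
  choose M hM hM' using hG
  refine ⟨∑ q ∈ Finset.HasAntidiagonal.antidiagonal N,
    (coeff q.1 (F a) • M q.2 + coeff q.2 (G a) • L q.1), ?_, ?_⟩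
  · simp_rw [coeff_mul]
    apply HasFDerivAt.fun_sum
    intro q _
    exact (hL q.1).mul (hM q.2)
  · intro ξ
    rw [show F a * G a * (g ξ + h ξ) = F a * (G a * h ξ) + (F a * g ξ) * G a by ring, map_add,
      coeff_mul, coeff_mul, ← Finset.sum_add_distrib, sum_apply]
    apply Finset.sum_congr rfl
    intro q _
    simp only [add_apply, smul_apply, smul_eq_mul, hL', hM']
    ring

theorem HasLogFDeriv.prod {ι : Type*} (s : Finset ι) {F g : ι → E → ℝ⟦X⟧} {a : E}
    (h : ∀ i ∈ s, HasLogFDeriv (F i) (g i) a) :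
    HasLogFDeriv (fun x => ∏ i ∈ s, F i x) (fun ξ => ∑ i ∈ s, g i ξ) a := by
  classical
  induction s using Finset.induction_on with
  | empty =>
    intro N
    exact ⟨0, by simpa using hasFDerivAt_const _ _, by simp⟩
  | insert i s hi ih =>
    simp_rw [Finset.prod_insert hi, Finset.sum_insert hi]
    exact (h i (Finset.mem_insert_self i s)).mul
      (ih fun j hj => h j (Finset.mem_insert_of_mem hj))

end LogDeriv

section Raise

variable {ι : Type*} [DecidableEq ι]

/-- The parameters `b` with the `i`-th one raised by one. -/
def raise (b : ι → ℝ) (i : ι) : ι → ℝ := b + Pi.single i 1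

theorem raise_self (b : ι → ℝ) (i : ι) : raise b i i = b i + 1 := by simp [raise]

theorem raise_of_ne (b : ι → ℝ) {i j : ι} (h : j ≠ i) : raise b i j = b j := by simp [raise, h]

theorem raise_nonneg {b : ι → ℝ} (hb : ∀ i, 0 ≤ b i) (i j : ι) : 0 ≤ raise b i j :=
  add_nonneg (hb j) ((Pi.single_nonneg.2 zero_le_one : (0 : ι → ℝ) ≤ Pi.single i 1) j)

theorem raise_comm (b : ι → ℝ) (i j : ι) : raise (raise b i) j = raise (raise b j) i :=
  add_right_comm _ _ _

end Raise

variable {ι : Type*} [Fintype ι]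

/-- The generating function `∏ᵢ (1 - aᵢ X)^{-bᵢ}` of the Dirichlet averages of powers. -/
def prodSeries (b a : ι → ℝ) : ℝ⟦X⟧ := ∏ i, negBinomial (b i) (a i)

theorem abs_coeff_prodSeries_le {b a : ι → ℝ} (hb : ∀ i, 0 ≤ b i) {A : ℝ}
    (ha : ∀ i, |a i| ≤ A) (N : ℕ) :
    |coeff N (prodSeries b a)| ≤ poch (∑ i, b i) N / N.factorial * A ^ N := by
  classical
  have key : ∀ (s : Finset ι) (N : ℕ), |coeff N (∏ i ∈ s, negBinomial (b i) (a i))| ≤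
      coeff N (∏ i ∈ s, negBinomial (b i) A) := by
    intro s
    induction s using Finset.induction_on with
    | empty =>
      intro N
      simp only [Finset.prod_empty, coeff_one]
      split_ifs <;> simp
    | insert i s hi ih =>
      intro N
      rw [Finset.prod_insert hi, Finset.prod_insert hi, coeff_mul, coeff_mul]
      refine (Finset.abs_sum_le_sum_abs _ _).trans (Finset.sum_le_sum fun q _ => ?_)
      have h0 := poch_nonneg (hb i) q.1
      have h1 : |coeff q.1 (negBinomial (b i) (a i))| ≤ coeff q.1 (negBinomial (b i) A) := by
        rw [coeff_negBinomial, coeff_negBinomial, abs_mul, abs_pow, abs_of_nonneg (by positivity)]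
        gcongr
        exact ha i
      rw [abs_mul]
      exact mul_le_mul h1 (ih q.2) (abs_nonneg _) ((abs_nonneg _).trans h1)
  have := key Finset.univ N
  rwa [prod_negBinomial, coeff_negBinomial] at this

/-- The confluent Lauricella function: the average of `exp (∑ aᵢ uᵢ)` over the Dirichlet
distribution with parameters `b`. -/
def lauricella (b a : ι → ℝ) : ℝ := ∑' N, coeff N (prodSeries b a) / poch (∑ i, b i) N

theorem summable_lauricella {b : ι → ℝ} (hb : ∀ i, 0 ≤ b i) (hb' : 0 < ∑ i, b i) (a : ι → ℝ) :
    Summable fun N => coeff N (prodSeries b a) / poch (∑ i, b i) N := by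
  refine Summable.of_norm_bounded (Real.summable_pow_div_factorial ‖a‖) fun N => ?_
  have h1 := abs_coeff_prodSeries_le hb (fun i => norm_le_pi_norm a i) N
  have h2 := poch_pos hb' N
  rw [Real.norm_eq_abs, abs_div, abs_of_pos h2, div_le_iff₀ h2]
  refine h1.trans (le_of_eq ?_)
  ring

theorem lauricella_zero (b : ι → ℝ) : lauricella b 0 = 1 := by
  unfold lauricella prodSeries
  simp only [Pi.zero_apply, prod_negBinomial, coeff_negBinomial]
  rw [tsum_eq_single 0]
  · simp [poch_zero]
  · intro N hN
    simp [hN]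

variable [DecidableEq ι]

theorem sum_raise (b : ι → ℝ) (i : ι) : ∑ j, (raise b i) j = (∑ j, b j) + 1 := by
  simp [raise, Finset.sum_add_distrib]

theorem prodSeries_raise (b a : ι → ℝ) (i : ι) :
    prodSeries (raise b i) a = prodSeries b a * negBinomial 1 (a i) := by
  unfold prodSeries
  rw [← Finset.mul_prod_erase _ _ (Finset.mem_univ i),
    ← Finset.mul_prod_erase _ (fun j => negBinomial (b j) (a j)) (Finset.mem_univ i)]
  have : ∏ j ∈ Finset.univ.erase i, negBinomial ((raise b i) j) (a j) =
      ∏ j ∈ Finset.univ.erase i, negBinomial (b j) (a j) := by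
    apply Finset.prod_congr rfl
    intro j hj
    rw [raise_of_ne _ (Finset.ne_of_mem_erase hj)]
  rw [this, raise_self, negBinomial_succ]
  ring

theorem one_sub_mul_prodSeries (b a : ι → ℝ) (i : ι) :
    (1 - C (a i) * X) * prodSeries (raise b i) a = prodSeries b a := by
  have h1 := one_sub_mul_negBinomial 0 (a i)
  rw [zero_add, negBinomial_zero] at h1
  rw [prodSeries_raise]
  linear_combination prodSeries b a * h1

theorem derivative_prodSeries (b a : ι → ℝ) :
    d⁄dX ℝ (prodSeries b a) = ∑ i, C (b i * a i) * prodSeries (raise b i) a := by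
  have key : ∀ s : Finset ι, d⁄dX ℝ (∏ i ∈ s, negBinomial (b i) (a i)) =
      (∑ i ∈ s, C (b i * a i) * negBinomial 1 (a i)) * ∏ i ∈ s, negBinomial (b i) (a i) := by
    intro s
    induction s using Finset.induction_on with
    | empty => simp
    | insert i s hi ih =>
      rw [Finset.prod_insert hi, Finset.sum_insert hi, Derivation.leibniz, ih,
        derivative_negBinomial, smul_eq_mul, smul_eq_mul]
      ring
  simp_rw [prodSeries_raise]
  unfold prodSeries
  rw [key, Finset.sum_mul]
  apply Finset.sum_congr rfl
  intro i _
  ring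

theorem sum_mul_coeff_prodSeries (b a : ι → ℝ) (N : ℕ) :
    ∑ i, b i * coeff N (prodSeries (raise b i) a) =
      ((∑ i, b i) + N) * coeff N (prodSeries b a) := by
  have h1 : X * d⁄dX ℝ (prodSeries b a) = ∑ i, C (b i) * (C (a i) * X *
      prodSeries (raise b i) a) := by
    rw [derivative_prodSeries, Finset.mul_sum]
    apply Finset.sum_congr rfl
    intro i _
    rw [map_mul]
    ring
  have h2 : ∀ i, C (a i) * X * prodSeries (raise b i) a =
      prodSeries (raise b i) a - prodSeries b a := by
    intro i
    linear_combination -one_sub_mul_prodSeries b a i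
  simp_rw [h2] at h1
  have h3 := congrArg (coeff N) h1
  simp only [map_sum, coeff_C_mul, map_sub] at h3
  simp only [mul_sub, Finset.sum_sub_distrib, ← Finset.sum_mul] at h3
  have h4 : coeff N (X * d⁄dX ℝ (prodSeries b a)) = N * coeff N (prodSeries b a) := by
    cases N with
    | zero => simp
    | succ N =>
      rw [coeff_succ_X_mul, coeff_derivative]
      push_cast
      ring
  linarith

theorem hasFDerivAt_coeff_prodSeries (b a : ι → ℝ) (N : ℕ) :
    HasFDerivAt (fun a => coeff N (prodSeries b a))
      (∑ i, (b i * coeff N (X * prodSeries (raise b i) a)) •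
        ContinuousLinearMap.proj (R := ℝ) (φ := fun _ : ι => ℝ) i) a := by
  have h1 : ∀ i ∈ (Finset.univ : Finset ι), HasLogFDeriv (fun x : ι → ℝ => negBinomial (b i) (x i))
      (fun ξ => C (b i * ξ i) * (X * negBinomial 1 (a i))) a := by
    intro i _ m
    refine ⟨(poch (b i) m / m.factorial * (m * a i ^ (m - 1))) •
      ContinuousLinearMap.proj (R := ℝ) (φ := fun _ : ι => ℝ) i, ?_, ?_⟩
    · simp_rw [coeff_negBinomial]
      have h2 : HasDerivAt (fun t : ℝ => poch (b i) m / m.factorial * t ^ m)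
          (poch (b i) m / m.factorial * (m * a i ^ (m - 1))) (a i) :=
        (hasDerivAt_pow m (a i)).const_mul _
      exact HasDerivAt.comp_hasFDerivAt (f := fun x : ι → ℝ => x i) a h2
        (ContinuousLinearMap.proj (R := ℝ) (φ := fun _ : ι => ℝ) i).hasFDerivAt
    · intro ξ
      rw [show negBinomial (b i) (a i) * (C (b i * ξ i) * (X * negBinomial 1 (a i))) =
        C (b i * ξ i) * (X * negBinomial (b i + 1) (a i)) by rw [negBinomial_succ]; ring,
        coeff_C_mul]
      cases m with
      | zero => simp
      | succ m =>
        rw [coeff_succ_X_mul, coeff_negBinomial, poch_succ_left, Nat.factorial_succ]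
        simp only [smul_apply, ContinuousLinearMap.proj_apply, smul_eq_mul]
        push_cast
        field_simp
  obtain ⟨L, hL, hL'⟩ := HasLogFDeriv.prod Finset.univ h1 N
  suffices h : (∑ i, (b i * coeff N (X * prodSeries (raise b i) a)) •
      ContinuousLinearMap.proj (R := ℝ) (φ := fun _ : ι => ℝ) i) = L by
    rw [h]
    exact hL
  ext1 ξ
  rw [hL', Finset.mul_sum, map_sum, sum_apply]
  apply Finset.sum_congr rfl
  intro i _
  rw [prodSeries_raise]
  unfold prodSeries
  beta_reduce
  rw [mul_left_comm _ (C _), coeff_C_mul, mul_left_comm _ X]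
  simp only [smul_apply, ContinuousLinearMap.proj_apply, smul_eq_mul]
  ring

theorem hasFDerivAt_lauricella {b : ι → ℝ} (hb : ∀ i, 0 ≤ b i) (hb' : 0 < ∑ i, b i) (a : ι → ℝ) :
    HasFDerivAt (lauricella b) (∑ i, (b i / (∑ j, b j) * lauricella (raise b i) a) •
        ContinuousLinearMap.proj (R := ℝ) (φ := fun _ : ι => ℝ) i) a := by
  set β := ∑ i, b i with hβ
  set L : ℕ → (ι → ℝ) → ((ι → ℝ) →L[ℝ] ℝ) := fun N a =>
    (poch β N)⁻¹ • ∑ i, (b i * coeff N (X * prodSeries (raise b i) a)) •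
        ContinuousLinearMap.proj (R := ℝ) (φ := fun _ : ι => ℝ) i with hL
  set A := ‖a‖ + 1 with hA
  set u : ℕ → ℝ := fun N => N.casesOn 0 fun M => A ^ M / M.factorial with hu
  have husum : Summable u := by
    rw [← summable_nat_add_iff 1]
    exact Real.summable_pow_div_factorial A
  have hproj : ∀ i, ‖ContinuousLinearMap.proj (R := ℝ) (φ := fun _ : ι => ℝ) i‖ ≤ 1 := fun i =>
    ContinuousLinearMap.opNorm_le_bound _ zero_le_one fun x => by
      rw [one_mul]; exact norm_le_pi_norm x i
  have hzero : ∀ x, L 0 x = 0 := fun x => by simp [hL]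
  have hsucc : ∀ N x, L (N + 1) x = ∑ i, (b i / β *
      (coeff N (prodSeries (raise b i) x) / poch (β + 1) N)) •
        ContinuousLinearMap.proj (R := ℝ) (φ := fun _ : ι => ℝ) i := by
    intro N x
    simp only [hL, Finset.smul_sum, smul_smul, coeff_succ_X_mul, poch_succ_left]
    refine Finset.sum_congr rfl fun i _ => ?_
    congr 1
    rw [mul_inv]
    ring
  have hbound : ∀ N x, x ∈ Metric.ball (0 : ι → ℝ) A → ‖L N x‖ ≤ u N := by
    intro N x hx
    cases N with
    | zero => exact (by rw [hzero, norm_zero] : ‖L 0 x‖ = 0).le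
    | succ N =>
      rw [hsucc]
      refine (norm_sum_le _ _).trans ?_
      have hx' : ∀ i, |x i| ≤ A := fun i =>
        (norm_le_pi_norm x i).trans (mem_ball_zero_iff.1 hx).le
      have hp := poch_pos (show 0 < β + 1 by linarith) N
      have hterm : ∀ i ∈ (Finset.univ : Finset ι), ‖(b i / β *
          (coeff N (prodSeries (raise b i) x) / poch (β + 1) N)) •
          ContinuousLinearMap.proj (R := ℝ) (φ := fun _ : ι => ℝ) i‖ ≤
          b i / β * (A ^ N / N.factorial) := by
        intro i _
        have h1 := abs_coeff_prodSeries_le (raise_nonneg hb i) hx' N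
        rw [sum_raise, ← hβ] at h1
        rw [norm_smul, Real.norm_eq_abs, abs_mul, abs_of_nonneg (div_nonneg (hb i) hb'.le), abs_div,
          abs_of_pos hp]
        have h2 : |coeff N (prodSeries (raise b i) x)| / poch (β + 1) N ≤
            A ^ N / N.factorial := by
          rw [div_le_iff₀ hp]
          exact h1.trans (le_of_eq (by ring))
        have h3 := mul_le_mul_of_nonneg_left h2 (div_nonneg (hb i) hb'.le)
        calc _ ≤ b i / β * (A ^ N / N.factorial) * 1 :=
              mul_le_mul h3 (hproj i) (norm_nonneg _) (mul_nonneg (div_nonneg (hb i) hb'.le)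
                (by positivity))
          _ = _ := mul_one _
      refine (Finset.sum_le_sum hterm).trans (le_of_eq ?_)
      rw [← Finset.sum_mul, ← Finset.sum_div, ← hβ, div_self hb'.ne', one_mul]
  have ha : a ∈ Metric.ball (0 : ι → ℝ) A := by rw [mem_ball_zero_iff, hA]; linarith
  have hd : ∀ N x, x ∈ Metric.ball (0 : ι → ℝ) A →
      HasFDerivAt (fun x => coeff N (prodSeries b x) / poch β N) (L N x) x := by
    intro N x _
    simp_rw [div_eq_inv_mul]
    exact (hasFDerivAt_coeff_prodSeries b x N).const_mul _
  have main := hasFDerivAt_tsum_of_isPreconnected husum Metric.isOpen_ball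
    (convex_ball (0 : ι → ℝ) A).isPreconnected hd hbound ha (summable_lauricella hb hb' a) ha
  have hs : HasSum (fun N => L (N + 1) a) (∑ i, (b i / β * lauricella (raise b i) a) •
      ContinuousLinearMap.proj (R := ℝ) (φ := fun _ : ι => ℝ) i) := by
    simp_rw [hsucc]
    apply hasSum_sum
    intro i _
    apply HasSum.smul_const
    apply HasSum.mul_left
    have := summable_lauricella (raise_nonneg hb i) (by rw [sum_raise]; linarith) a
    rw [sum_raise] at this
    unfold lauricella
    rw [sum_raise]
    exact this.hasSum
  have hs' := ((hasSum_nat_add_iff (f := fun N => L N a) 1).1 hs).tsum_eq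
  rw [Finset.sum_range_one, hzero, add_zero] at hs'
  rw [hs'] at main
  exact main

theorem contDiff_lauricella {b : ι → ℝ} (hb : ∀ i, 0 ≤ b i) (hb' : 0 < ∑ i, b i) :
    ContDiff ℝ ∞ (lauricella b) := by
  rw [contDiff_infty]
  intro n
  induction n generalizing b with
  | zero =>
    exact contDiff_zero.2 (continuous_iff_continuousAt.2 fun a =>
      (hasFDerivAt_lauricella hb hb' a).continuousAt)
  | succ n ih =>
    push_cast
    rw [contDiff_succ_iff_hasFDerivAt]
    refine ⟨_, ?_, hasFDerivAt_lauricella hb hb'⟩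
    apply ContDiff.sum
    intro i _
    refine ContDiff.fun_smul (contDiff_const.mul (ih ?_ ?_)) contDiff_const
    · exact raise_nonneg hb i
    · rw [sum_raise]
      linarith

theorem lauricella_eq_sum {b : ι → ℝ} (hb : ∀ i, 0 ≤ b i) (hb' : 0 < ∑ i, b i) (a : ι → ℝ) :
    lauricella b a = ∑ i, b i / (∑ j, b j) * lauricella (raise b i) a := by
  have hs : HasSum (fun N => ∑ i, b i / (∑ j, b j) *
      (coeff N (prodSeries (raise b i) a) / poch (∑ j, (raise b i) j) N))
      (∑ i, b i / (∑ j, b j) * lauricella (raise b i) a) := by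
    apply hasSum_sum
    intro i _
    apply HasSum.mul_left
    refine (summable_lauricella (raise_nonneg hb i) ?_ a).hasSum
    rw [sum_raise]
    linarith
  rw [← hs.tsum_eq]
  unfold lauricella
  congr 1
  funext N
  have h1 := sum_mul_coeff_prodSeries b a N
  have h2 := poch_pos hb' N
  have h3 : (∑ j, b j) * poch ((∑ j, b j) + 1) N = poch (∑ j, b j) N * ((∑ j, b j) + N) := by
    rw [← poch_succ_left, poch_succ]
  have h4 := poch_pos (show 0 < (∑ j, b j) + 1 by linarith) N
  simp_rw [sum_raise]
  have h5 : ∑ i, b i / (∑ j, b j) *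
      (coeff N (prodSeries (raise b i) a) / poch ((∑ j, b j) + 1) N) =
      (∑ i, b i * coeff N (prodSeries (raise b i) a)) /
        ((∑ j, b j) * poch ((∑ j, b j) + 1) N) := by
    rw [Finset.sum_div]
    refine Finset.sum_congr rfl fun i _ => ?_
    field_simp
  rw [h5, h1, h3]
  have h6 : 0 < (∑ j, b j) + (N : ℝ) := by positivity
  field_simp

theorem sub_mul_lauricella {b : ι → ℝ} (hb : ∀ i, 0 ≤ b i) (hb' : 0 < ∑ i, b i) (a : ι → ℝ)
    (i j : ι) :
    (a i - a j) * lauricella (raise (raise b i) j) a =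
      ((∑ j, b j) + 1) * (lauricella (raise b i) a - lauricella (raise b j) a) := by
  set β := ∑ j, b j with hβ
  have key : C (a i - a j) * (X * prodSeries (raise (raise b i) j) a) =
      prodSeries (raise b i) a - prodSeries (raise b j) a := by
    have h1 := one_sub_mul_prodSeries (raise b i) a j
    have h2 := one_sub_mul_prodSeries (raise b j) a i
    rw [raise_comm] at h2
    rw [map_sub]
    linear_combination h1 - h2
  have s1 := summable_lauricella (raise_nonneg hb i) (by rw [sum_raise]; linarith) a
  have s2 := summable_lauricella (raise_nonneg hb j) (by rw [sum_raise]; linarith) a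
  unfold lauricella
  rw [← Summable.tsum_sub s1 s2, Summable.tsum_eq_zero_add (s1.sub s2), ← tsum_mul_left, mul_add,
    ← tsum_mul_left]
  simp_rw [sum_raise, ← sub_div, ← map_sub, ← key, ← hβ]
  have h0 : coeff 0 (C (a i - a j) * (X * prodSeries (raise (raise b i) j) a)) = 0 := by
    rw [coeff_C_mul, coeff_zero_X_mul, mul_zero]
  rw [h0, zero_div, mul_zero, zero_add]
  congr 1
  funext N
  rw [coeff_C_mul, coeff_succ_X_mul, poch_succ_left]
  have : β + 1 ≠ 0 := by positivity
  have := poch_pos (show 0 < β + 1 + 1 by linarith) N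
  field_simp

end Lauricella

end

noncomputable section

theorem lauricella_comp_equiv {ι : Type*} [Fintype ι] (b a : ι → ℝ) (π : ι ≃ ι) :
    lauricella (b ∘ π) (a ∘ π) = lauricella b a := by
  unfold lauricella prodSeries
  simp only [Function.comp_apply, Equiv.prod_comp π fun i => negBinomial (b i) (a i),
    Equiv.sum_comp π]

theorem reflectionQuotient_eq {α : ℂ} (hα : ‖α‖ = 1) {f g : ℂ → ℝ} (hf : Differentiable ℝ f)
    (hg : Differentiable ℝ g)
    (h : ∀ y, f y - f (rootReflection α y) = inner ℝ α y * g y) (y : ℂ) :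
    reflectionQuotient α f y = g y := by
  have h1 : inner ℝ α α = (1 : ℝ) := by rw [real_inner_self_eq_norm_sq, hα, one_pow]
  unfold reflectionQuotient
  split_ifs with h0
  · have hl : ∀ s t : ℝ, HasDerivAt (fun t : ℝ => y + (s * t) • α) (s • α) t := by
      intro s t
      have := ((((hasDerivAt_id t).const_mul s).smul_const α).const_add y)
      simpa using this
    have d1 : HasDerivAt (fun t : ℝ => f (y + (1 * t) • α) - f (y + (-1 * t) • α))
        (fderiv ℝ f y ((1 : ℝ) • α) - fderiv ℝ f y ((-1 : ℝ) • α)) 0 := by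
      apply HasDerivAt.sub
      · refine HasFDerivAt.comp_hasDerivAt (f := fun t : ℝ => y + (1 * t) • α) 0 ?_ (hl 1 0)
        simpa using (hf y).hasFDerivAt
      · refine HasFDerivAt.comp_hasDerivAt (f := fun t : ℝ => y + (-1 * t) • α) 0 ?_ (hl (-1) 0)
        simpa using (hf y).hasFDerivAt
    have d2 : HasDerivAt (fun t : ℝ => t * g (y + (1 * t) • α))
        (1 * g (y + (1 * (0 : ℝ)) • α) + 0 * fderiv ℝ g y ((1 : ℝ) • α)) 0 := by
      apply HasDerivAt.mul (hasDerivAt_id' 0)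
      refine HasFDerivAt.comp_hasDerivAt (f := fun t : ℝ => y + (1 * t) • α) 0 ?_ (hl 1 0)
      simpa using (hg y).hasFDerivAt
    have e : (fun t : ℝ => f (y + (1 * t) • α) - f (y + (-1 * t) • α)) =
        fun t : ℝ => t * g (y + (1 * t) • α) := by
      funext t
      have h2 := h (y + (1 * t) • α)
      have h3 : rootReflection α (y + (1 * t) • α) = y + (-1 * t) • α := by
        unfold rootReflection
        rw [inner_add_right, real_inner_smul_right, h0, h1]
        module
      rw [h3, inner_add_right, real_inner_smul_right, h0, h1] at h2
      rw [h2]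
      ring
    rw [e] at d1
    have := d1.unique d2
    rw [h1]
    simp only [one_smul, neg_smul, map_neg, mul_zero, zero_smul, add_zero, zero_mul, one_mul] at this
    linarith
  · rw [h y, mul_div_cancel_left₀ _ h0]

section Orbit

variable {n : ℕ}

/-- The `n`-th roots of unity, which index the orbit of the point `1` under `D₂(n)`. -/
abbrev RootIndex (n : ℕ) : Type := Polynomial.nthRootsFinset n (1 : ℂ)

/-- The functionals `y ↦ ⟨ρ τ, y⟩` for `ρ τ` in the orbit of `ρ`. -/
def orbitInner (n : ℕ) (ρ : ℝ) : ℂ →L[ℝ] (RootIndex n → ℝ) :=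
  ContinuousLinearMap.pi fun τ => ρ • innerSL ℝ (τ : ℂ)

theorem orbitInner_apply (ρ : ℝ) (y : ℂ) (τ : RootIndex n) :
    orbitInner n ρ y τ = ρ * inner ℝ (τ : ℂ) y := by
  simp [orbitInner]

theorem conj_mem (hn : 0 < n) (η τ : RootIndex n) :
    (η : ℂ) * starRingEnd ℂ τ ∈ Polynomial.nthRootsFinset n (1 : ℂ) := by
  rw [Polynomial.mem_nthRootsFinset hn, mul_pow, ← map_pow,
    (Polynomial.mem_nthRootsFinset hn 1).1 η.2, (Polynomial.mem_nthRootsFinset hn 1).1 τ.2]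
  simp

/-- The action of the reflection `z ↦ η * conj z` on the roots of unity. -/
def reflectIndex (hn : 0 < n) (η : RootIndex n) : RootIndex n ≃ RootIndex n :=
  Function.Involutive.toPerm (fun τ => ⟨η * starRingEnd ℂ τ, conj_mem hn η τ⟩) fun τ => by
    apply Subtype.ext
    have h : (η : ℂ) * starRingEnd ℂ η = 1 := by
      rw [Complex.mul_conj, Complex.normSq_eq_norm_sq, norm_eq_one_of_mem_nthRootsFinset hn η.2]
      simp
    simp only [map_mul, Complex.conj_conj]
    rw [← mul_assoc, h, one_mul]

theorem coe_reflectIndex (hn : 0 < n) (η τ : RootIndex n) :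
    (reflectIndex hn η τ : ℂ) = η * starRingEnd ℂ τ := rfl

theorem orbitInner_reflect (hn : 0 < n) (ρ : ℝ) (η : RootIndex n) (y : ℂ) :
    orbitInner n ρ (η * starRingEnd ℂ y) = orbitInner n ρ y ∘ reflectIndex hn η := by
  funext τ
  rw [Function.comp_apply, orbitInner_apply, orbitInner_apply, coe_reflectIndex, Complex.inner,
    Complex.inner]
  congr 1
  simp only [map_mul, Complex.mul_re, Complex.mul_im, Complex.conj_re, Complex.conj_im]
  ring

/-- The root of unity `1`. -/
def indexOne (hn : 0 < n) : RootIndex n := ⟨1, Polynomial.one_mem_nthRootsFinset hn⟩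

theorem reflectIndex_indexOne (hn : 0 < n) (η : RootIndex n) :
    reflectIndex hn η (indexOne hn) = η := by
  apply Subtype.ext
  simp [coe_reflectIndex, indexOne]

theorem lauricella_const_reflect (hn : 0 < n) (k ρ : ℝ) (η : RootIndex n) (y : ℂ) :
    lauricella (fun _ => k) (orbitInner n ρ (η * starRingEnd ℂ y)) =
      lauricella (fun _ => k) (orbitInner n ρ y) := by
  rw [orbitInner_reflect hn]
  exact lauricella_comp_equiv (fun _ => k) _ (reflectIndex hn η)

theorem lauricella_raise_reflect (hn : 0 < n) (k ρ : ℝ) (η : RootIndex n) (y : ℂ) :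
    lauricella (raise (fun _ => k) (indexOne hn)) (orbitInner n ρ (η * starRingEnd ℂ y)) =
      lauricella (raise (fun _ => k) η) (orbitInner n ρ y) := by
  rw [orbitInner_reflect hn, ← lauricella_comp_equiv (raise (fun _ => k) η) _ (reflectIndex hn η)]
  congr 1
  funext τ
  rw [Function.comp_apply]
  by_cases h : τ = indexOne hn
  · subst h
    rw [reflectIndex_indexOne, raise_self, raise_self]
  · rw [raise_of_ne _ h, raise_of_ne]
    intro h'
    apply h
    exact (reflectIndex hn η).injective (h'.trans (reflectIndex_indexOne hn η).symm)

theorem card_rootIndex (hn : 0 < n) : Fintype.card (RootIndex n) = n := by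
  rw [Fintype.card_coe, (Complex.isPrimitiveRoot_exp n hn.ne').card_nthRootsFinset]

theorem sum_const_rootIndex (hn : 0 < n) (k : ℝ) : ∑ _i : RootIndex n, k = n * k := by
  rw [Finset.sum_const, Finset.card_univ, card_rootIndex hn, nsmul_eq_mul]

/-- The multiplier `η` of the reflection `σ_j z = η * conj z`. -/
def reflectionIndex (hn : 0 < n) (j : ℕ) : RootIndex n :=
  ⟨Complex.exp (2 * Real.pi * Complex.I / n) * Complex.exp (2 * Real.pi * Complex.I / n) ^ j, by
    rw [Polynomial.mem_nthRootsFinset hn, ← pow_succ', ← pow_mul, mul_comm (j + 1), pow_mul,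
      (Complex.isPrimitiveRoot_exp n hn.ne').pow_eq_one, one_pow]⟩

theorem sum_reflectionIndex (hn : 0 < n) (F : RootIndex n → ℝ) :
    ∑ j ∈ Finset.range n, F (reflectionIndex hn j) = ∑ τ, F τ := by
  classical
  set G : ℂ → ℝ := fun τ =>
    if h : τ ∈ Polynomial.nthRootsFinset n (1 : ℂ) then F ⟨τ, h⟩ else 0 with hG
  have hζ := Complex.isPrimitiveRoot_exp n hn.ne'
  have h1 : ∀ j, F (reflectionIndex hn j) = G (Complex.exp (2 * Real.pi * Complex.I / n) *
      Complex.exp (2 * Real.pi * Complex.I / n) ^ j) := by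
    intro j
    have h : Complex.exp (2 * Real.pi * Complex.I / n) *
        Complex.exp (2 * Real.pi * Complex.I / n) ^ j ∈ Polynomial.nthRootsFinset n (1 : ℂ) :=
      (reflectionIndex hn j).2
    simp only [hG, dif_pos h]
    rfl
  simp_rw [h1]
  rw [sum_range_pow_eq_sum_nthRootsFinset hζ hn
      (fun τ => G (Complex.exp (2 * Real.pi * Complex.I / n) * τ)),
    sum_nthRootsFinset_mul hn hζ.pow_eq_one, ← Finset.sum_coe_sort]
  refine Finset.sum_congr rfl fun τ _ => ?_
  simp [hG]

theorem rootReflection_eq_reflectionIndex (hn : 0 < n) (j : ℕ) (z : ℂ) :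
    rootReflection (dihedralRoot n j) z = reflectionIndex hn j * starRingEnd ℂ z :=
  rootReflection_dihedralRoot n j z

theorem two_mul_inner_smul_dihedralRoot (hn : 0 < n) (j : ℕ) :
    (2 * inner ℝ (dihedralRoot n j) (1 : ℂ)) • dihedralRoot n j = 1 - reflectionIndex hn j := by
  have h := rootReflection_eq_reflectionIndex hn j 1
  rw [map_one, mul_one] at h
  rw [← h, rootReflection, inner_dihedralRoot_self, div_one]
  module

/-- The Dunkl kernel at a point `ρ` on a wall, as a confluent Lauricella function. -/
theorem isDunklEigenfunction_lauricella (hn : 0 < n) {k : ℝ} (hk : 0 < k) (ρ : ℝ) :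
    IsDunklEigenfunction n k (ρ : ℂ)
      fun y => lauricella (raise (fun _ => k) (indexOne hn)) (orbitInner n ρ y) := by
  have hb0 : ∀ i : RootIndex n, (0 : ℝ) ≤ (fun _ => k) i := fun _ => hk.le
  have hn' : (0 : ℝ) < n := by exact_mod_cast hn
  have hs0 := sum_const_rootIndex hn k
  have hs0' : 0 < ∑ _i : RootIndex n, k := by rw [hs0]; positivity
  set b : RootIndex n → ℝ := raise (fun _ => k) (indexOne hn) with hb
  have hbn : ∀ i, 0 ≤ b i := raise_nonneg hb0 _
  have hbs : ∑ i, b i = n * k + 1 := by rw [hb, sum_raise, hs0]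
  have hbs' : 0 < ∑ i, b i := by rw [hbs]; positivity
  have hbr : ∀ i, ContDiff ℝ ∞ fun y => lauricella (raise b i) (orbitInner n ρ y) := fun i =>
    (contDiff_lauricella (raise_nonneg hbn i) (by rw [sum_raise]; linarith)).comp
      (orbitInner n ρ).contDiff
  have hE : ContDiff ℝ ∞ fun y => lauricella b (orbitInner n ρ y) :=
    (contDiff_lauricella hbn hbs').comp (orbitInner n ρ).contDiff
  refine ⟨hE, ?_, ?_⟩
  · rw [map_zero, lauricella_zero]
  · intro ξ y
    have hq : ∀ j, reflectionQuotient (dihedralRoot n j)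
        (fun y => lauricella b (orbitInner n ρ y)) y =
        2 * ρ * inner ℝ (dihedralRoot n j) (1 : ℂ) / (n * k + 1) *
          lauricella (raise b (reflectionIndex hn j)) (orbitInner n ρ y) := by
      intro j
      refine reflectionQuotient_eq (norm_dihedralRoot n j) (hE.differentiable (by simp))
        (((hbr (reflectionIndex hn j)).differentiable (by simp)).const_mul _) (fun z => ?_) y
      rw [rootReflection_eq_reflectionIndex hn]
      have h1 := sub_mul_lauricella hb0 hs0' (orbitInner n ρ z) (indexOne hn)
        (reflectionIndex hn j)
      rw [hs0, orbitInner_apply, orbitInner_apply, ← mul_sub, ← inner_sub_left] at h1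
      have h2 : ((indexOne hn : RootIndex n) : ℂ) - reflectionIndex hn j =
          (2 * inner ℝ (dihedralRoot n j) (1 : ℂ)) • dihedralRoot n j :=
        (two_mul_inner_smul_dihedralRoot hn j).symm
      rw [h2, real_inner_smul_left] at h1
      rw [hb, lauricella_raise_reflect hn]
      have h3 : (n : ℝ) * k + 1 ≠ 0 := by positivity
      field_simp
      linear_combination -h1
    have hd : fderiv ℝ (fun y => lauricella b (orbitInner n ρ y)) y ξ =
        ∑ i, b i / (n * k + 1) * lauricella (raise b i) (orbitInner n ρ y) *
          (ρ * inner ℝ (i : ℂ) ξ) := by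
      have h1 := (hasFDerivAt_lauricella hbn hbs' (orbitInner n ρ y)).comp y
        (orbitInner n ρ).hasFDerivAt
      have h2 : HasFDerivAt (fun y => lauricella b (orbitInner n ρ y)) _ y := h1
      rw [h2.fderiv, ContinuousLinearMap.comp_apply, sum_apply]
      refine Finset.sum_congr rfl fun i _ => ?_
      rw [smul_apply, ContinuousLinearMap.proj_apply, orbitInner_apply, smul_eq_mul, hbs]
    have hsum : ∑ j ∈ Finset.range n, inner ℝ (dihedralRoot n j) ξ *
        reflectionQuotient (dihedralRoot n j) (fun y => lauricella b (orbitInner n ρ y)) y =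
        ∑ i : RootIndex n, ρ * (inner ℝ (1 : ℂ) ξ - inner ℝ (i : ℂ) ξ) / (n * k + 1) *
          lauricella (raise b i) (orbitInner n ρ y) := by
      rw [← sum_reflectionIndex hn]
      refine Finset.sum_congr rfl fun j _ => ?_
      rw [hq, ← inner_sub_left, ← two_mul_inner_smul_dihedralRoot hn j, real_inner_smul_left]
      ring
    have hx : inner ℝ ξ (ρ : ℂ) = ρ * inner ℝ (1 : ℂ) ξ := by
      rw [real_inner_comm, ← real_inner_smul_left]
      congr 1
      simp
    unfold dunklOperator
    rw [hd, hsum, hx, lauricella_eq_sum hbn hbs', hbs, Finset.mul_sum, Finset.mul_sum,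
      ← Finset.sum_add_distrib]
    refine Finset.sum_congr rfl fun i _ => ?_
    by_cases hi : i = indexOne hn
    · subst hi
      have : ((indexOne hn : RootIndex n) : ℂ) = 1 := rfl
      rw [this]
      ring
    · rw [hb, raise_of_ne _ hi]
      ring

theorem dunklKernel_eq_lauricella (hn : 0 < n) {k : ℝ} (hk : 0 < k) (ρ : ℝ) :
    dunklKernel n k (ρ : ℂ) =
      fun y => lauricella (raise (fun _ => k) (indexOne hn)) (orbitInner n ρ y) := by
  have h := isDunklEigenfunction_lauricella hn hk ρ
  exact IsDunklEigenfunction.unique hn hk.le (Classical.epsilon_spec ⟨_, h⟩) h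

theorem generalizedBessel_eq_lauricella (hn : 0 < n) {k : ℝ} (hk : 0 < k) (ρ : ℝ) (y : ℂ) :
    generalizedBessel n k (ρ : ℂ) y = lauricella (fun _ => k) (orbitInner n ρ y) := by
  have hn' : (0 : ℝ) < n := by exact_mod_cast hn
  have hs0 := sum_const_rootIndex hn k
  have hζ := Complex.isPrimitiveRoot_exp n hn.ne'
  have hrot : ∀ j z, dihedralRotation n j z = Complex.exp (2 * Real.pi * Complex.I / n) ^ j * z := by
    intro j z
    rw [dihedralRotation, ← Complex.exp_nat_mul]
    congr 2
    push_cast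
    ring
  set ζ := Complex.exp (2 * Real.pi * Complex.I / n) with hζdef
  have havg : ∀ z, ∑ j ∈ Finset.range n, dunklKernel n k ρ (dihedralRotation n j (starRingEnd ℂ z)) =
      n * lauricella (fun _ => k) (orbitInner n ρ z) := by
    intro z
    rw [lauricella_eq_sum (fun _ => hk.le) (by rw [hs0]; positivity), hs0, ← Finset.mul_sum,
      ← mul_assoc]
    have h1 : (n : ℝ) * (k / (n * k)) = 1 := by field_simp
    rw [h1, one_mul, ← sum_reflectionIndex hn]
    simp_rw [hrot]
    rw [sum_range_pow_eq_sum_nthRootsFinset hζ hn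
        (fun τ => dunklKernel n k ρ (τ * starRingEnd ℂ z)),
      ← sum_nthRootsFinset_mul hn hζ.pow_eq_one, ← sum_range_pow_eq_sum_nthRootsFinset hζ hn]
    refine Finset.sum_congr rfl fun j _ => ?_
    rw [dunklKernel_eq_lauricella hn hk, ← lauricella_raise_reflect hn]
    rfl
  unfold generalizedBessel
  rw [Finset.sum_add_distrib, havg y]
  have h2 := havg (starRingEnd ℂ y)
  rw [Complex.conj_conj] at h2
  have h3 := lauricella_const_reflect hn k ρ (indexOne hn) y
  rw [show ((indexOne hn : RootIndex n) : ℂ) = 1 from rfl, one_mul] at h3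
  rw [h2, h3]
  field_simp
  ring

end Orbit

open PowerSeries in
/-- The generalized Bessel function of `D₂(2p)` at a point of a wall: opposite points of the orbit
combine to even series. -/
theorem hasSum_generalizedBessel {p : ℕ} (hp : 0 < p) {k : ℝ} (hk : 0 < k) (ρ : ℝ) (y : ℂ)
    {η : ℂ} (hη : IsPrimitiveRoot η (2 * p)) :
    HasSum (fun m => coeff m (∏ s ∈ Finset.range p, negBinomial k ((ρ * inner ℝ (η ^ s) y) ^ 2)) /
        poch (2 * p * k) (2 * m)) (generalizedBessel (2 * p) k (ρ : ℂ) y) := by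
  have hn : 0 < 2 * p := by positivity
  have hs := (summable_lauricella (fun _ => hk.le) (by rw [sum_const_rootIndex hn]; positivity)
    (orbitInner (2 * p) ρ y)).hasSum
  rw [generalizedBessel_eq_lauricella hn hk]
  unfold lauricella
  unfold prodSeries at hs ⊢
  rw [sum_const_rootIndex hn] at hs ⊢
  have hηp : η ^ p = -1 := by
    have h1 : (η ^ p) ^ 2 = 1 := by rw [← pow_mul, mul_comm, hη.pow_eq_one]
    rcases (sq_eq_sq_iff_eq_or_eq_neg.1 (h1.trans (one_pow 2).symm)) with h | h
    · have := hη.dvd_of_pow_eq_one p h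
      have := Nat.le_of_dvd hp this
      omega
    · exact h
  have hprod : ∏ i : RootIndex (2 * p), negBinomial k (orbitInner (2 * p) ρ y i) =
      expand 2 two_ne_zero
        (∏ s ∈ Finset.range p, negBinomial k ((ρ * inner ℝ (η ^ s) y) ^ 2)) := by
    simp_rw [orbitInner_apply]
    rw [Finset.prod_coe_sort (Polynomial.nthRootsFinset (2 * p) (1 : ℂ))
      (fun τ => negBinomial k (ρ * inner ℝ τ y)),
      ← prod_range_pow_eq_prod_nthRootsFinset hη hn, two_mul, Finset.prod_range_add, map_prod,
      ← Finset.prod_mul_distrib]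
    refine Finset.prod_congr rfl fun s _ => ?_
    rw [← negBinomial_mul_negBinomial_neg, pow_add, hηp, neg_one_mul, inner_neg_left, mul_neg]
  rw [hprod] at hs ⊢
  have hinj : Function.Injective fun m : ℕ => 2 * m := fun i j h => by simpa using h
  rw [← hinj.hasSum_iff] at hs
  · convert hs using 2 with m
    rw [Function.comp_apply, coeff_expand_mul]
    push_cast
    rfl
  · intro N hN
    rw [coeff_expand_of_not_dvd, zero_div]
    rintro ⟨m, rfl⟩
    exact hN ⟨m, rfl⟩

end

noncomputable section

open scoped ENNReal

/-- The density `x^{b-1}` on the positive half-line, extended by zero. -/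
def posPow (b x : ℝ) : ℝ≥0∞ := if 0 < x then ENNReal.ofReal (x ^ (b - 1)) else 0

theorem posPow_of_pos (b : ℝ) {x : ℝ} (hx : 0 < x) : posPow b x = ENNReal.ofReal (x ^ (b - 1)) :=
  if_pos hx

theorem posPow_of_nonpos (b : ℝ) {x : ℝ} (hx : x ≤ 0) : posPow b x = 0 := if_neg hx.not_gt

theorem posPow_one (b : ℝ) : posPow b 1 = 1 := by simp [posPow]

@[fun_prop]
theorem measurable_posPow (b : ℝ) : Measurable (posPow b) := by
  unfold posPow
  exact Measurable.ite measurableSet_Ioi (by fun_prop) measurable_const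

theorem posPow_mul_left (b : ℝ) {c : ℝ} (hc : 0 < c) (x : ℝ) :
    posPow b (c * x) = ENNReal.ofReal (c ^ (b - 1)) * posPow b x := by
  by_cases hx : 0 < x
  · rw [posPow_of_pos _ hx, posPow_of_pos _ (mul_pos hc hx), Real.mul_rpow hc.le hx.le,
      ENNReal.ofReal_mul (by positivity)]
  · rw [posPow_of_nonpos _ (not_lt.1 hx),
      posPow_of_nonpos _ (mul_nonpos_of_nonneg_of_nonpos hc.le (not_lt.1 hx)), mul_zero]

theorem posPow_mul_pow (b x : ℝ) (m : ℕ) :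
    posPow b x * ENNReal.ofReal (x ^ m) = posPow (b + m) x := by
  by_cases hx : 0 < x
  · rw [posPow_of_pos _ hx, posPow_of_pos _ hx, ← ENNReal.ofReal_mul (by positivity),
      ← Real.rpow_add_natCast hx.ne']
    congr 2
    ring
  · rw [posPow_of_nonpos _ (not_lt.1 hx), posPow_of_nonpos _ (not_lt.1 hx), zero_mul]

theorem lintegral_eq_mul_lintegral_comp_mul {c : ℝ} (hc : 0 < c) {f : ℝ → ℝ≥0∞}
    (hf : Measurable f) : ∫⁻ x, f x = ENNReal.ofReal c * ∫⁻ x, f (c * x) := by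
  rw [← lintegral_map hf (measurable_const_mul c), Real.map_volume_mul_left hc.ne',
    lintegral_smul_measure, smul_eq_mul, ← mul_assoc, ← ENNReal.ofReal_mul hc.le, abs_inv,
    abs_of_pos hc, mul_inv_cancel₀ hc.ne', ENNReal.ofReal_one, one_mul]

theorem lintegral_posPow_mul_posPow {a b : ℝ} (ha : 0 < a) (hb : 0 < b) (c : ℝ) :
    ∫⁻ x, posPow a x * posPow b (c - x) =
      ENNReal.ofReal (ProbabilityTheory.beta a b) * posPow (a + b) c := by
  have hbeta := ProbabilityTheory.beta_pos ha hb
  have h1 : ∫⁻ x, posPow a x * posPow b (1 - x) = ENNReal.ofReal (ProbabilityTheory.beta a b) := by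
    have h := ProbabilityTheory.lintegral_betaPDF_eq_one ha hb
    have e : ∀ x, posPow a x * posPow b (1 - x) = ENNReal.ofReal (ProbabilityTheory.beta a b) *
        ProbabilityTheory.betaPDF a b x := by
      intro x
      rw [ProbabilityTheory.betaPDF_eq]
      by_cases h0 : 0 < x
      · by_cases h1 : x < 1
        · rw [posPow_of_pos _ h0, posPow_of_pos _ (sub_pos.2 h1), if_pos ⟨h0, h1⟩,
            ← ENNReal.ofReal_mul (by positivity), ← ENNReal.ofReal_mul hbeta.le]
          congr 1
          field_simp
        · rw [posPow_of_nonpos b (sub_nonpos.2 (not_lt.1 h1)), if_neg fun h => h1 h.2]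
          simp
      · rw [posPow_of_nonpos a (not_lt.1 h0), if_neg fun h => h0 h.1]
        simp
    simp_rw [e]
    rw [lintegral_const_mul _ (by
      unfold ProbabilityTheory.betaPDF
      fun_prop), h, mul_one]
  by_cases hc : 0 < c
  · rw [lintegral_eq_mul_lintegral_comp_mul hc (by fun_prop)]
    have e : ∀ x, posPow a (c * x) * posPow b (c - c * x) =
        ENNReal.ofReal (c ^ (a - 1) * c ^ (b - 1)) * (posPow a x * posPow b (1 - x)) := by
      intro x
      rw [show c - c * x = c * (1 - x) by ring, posPow_mul_left _ hc, posPow_mul_left _ hc,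
        ENNReal.ofReal_mul (by positivity)]
      ring
    simp_rw [e]
    rw [lintegral_const_mul _ (by fun_prop), h1, posPow_of_pos _ hc, ← mul_assoc,
      ← ENNReal.ofReal_mul hc.le, mul_comm]
    congr 2
    nth_rewrite 1 [← Real.rpow_one c]
    rw [← Real.rpow_add hc, ← Real.rpow_add hc]
    congr 1
    ring
  · rw [posPow_of_nonpos _ (not_lt.1 hc), mul_zero, lintegral_eq_zero_iff (by fun_prop)]
    refine Filter.Eventually.of_forall fun x => ?_
    by_cases h0 : 0 < x
    · simp only [Pi.zero_apply]
      rw [posPow_of_nonpos b (by linarith [not_lt.1 hc]), mul_zero]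
    · simp only [Pi.zero_apply]
      rw [posPow_of_nonpos a (not_lt.1 h0), zero_mul]

/-- The barycentric coordinates `(c - ∑ uᵢ, u₁, …, u_q)` of a point of the simplex of size `c`. -/
def baryCoord {q : ℕ} (c : ℝ) (u : Fin q → ℝ) : Fin (q + 1) → ℝ := Fin.cons (c - ∑ i, u i) u

@[fun_prop]
theorem measurable_baryCoord {q : ℕ} (c : ℝ) (i : Fin (q + 1)) :
    Measurable fun u : Fin q → ℝ => baryCoord c u i := by
  unfold baryCoord
  cases i using Fin.cases with
  | zero => simp only [Fin.cons_zero]; fun_prop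
  | succ i => simp only [Fin.cons_succ]; fun_prop

/-- The Dirichlet integral over the simplex of size `c`. -/
theorem lintegral_prod_posPow {q : ℕ} (b : Fin (q + 1) → ℝ) (hb : ∀ i, 0 < b i) (c : ℝ) :
    ∫⁻ u : Fin q → ℝ, ∏ i, posPow (b i) (baryCoord c u i) =
      ENNReal.ofReal ((∏ i, Real.Gamma (b i)) / Real.Gamma (∑ i, b i)) * posPow (∑ i, b i) c := by
  induction q generalizing c with
  | zero =>
    have h := (Real.Gamma_pos_of_pos (hb 0)).ne'
    rw [volume_pi, Measure.pi_of_empty, lintegral_dirac]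
    simp [baryCoord, div_self h]
  | succ q ih =>
    have hmp := (volume_preserving_piFinSuccAbove (fun _ : Fin (q + 1) => ℝ) 0).symm
    rw [← hmp.lintegral_comp (by fun_prop), Measure.volume_eq_prod, lintegral_prod _ (by
      have : Measurable fun u : Fin (q + 1) → ℝ => ∏ i, posPow (b i) (baryCoord c u i) := by
        fun_prop
      exact (this.comp (MeasurableEquiv.measurable _)).aemeasurable)]
    set b' : Fin (q + 1) → ℝ := Fin.cons (b 0) fun i => b i.succ.succ with hb'
    have hb'pos : ∀ i, 0 < b' i := by
      intro i
      cases i using Fin.cases with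
      | zero => simpa [hb'] using hb 0
      | succ i => simpa [hb'] using hb i.succ.succ
    have e : ∀ (x : ℝ) (v : Fin q → ℝ), ∏ i, posPow (b i) (baryCoord c
        ((MeasurableEquiv.piFinSuccAbove (fun _ : Fin (q + 1) => ℝ) 0).symm (x, v)) i) =
        posPow (b 1) x * ∏ i, posPow (b' i) (baryCoord (c - x) v i) := by
      intro x v
      have e1 : (MeasurableEquiv.piFinSuccAbove (fun _ : Fin (q + 1) => ℝ) 0).symm (x, v) =
          Fin.cons x v := by
        simp [MeasurableEquiv.piFinSuccAbove, Fin.insertNthEquiv]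
      rw [e1, Fin.prod_univ_succ, Fin.prod_univ_succ, Fin.prod_univ_succ (fun i => posPow (b' i) _)]
      simp only [baryCoord, Fin.cons_zero, Fin.cons_succ, Fin.sum_univ_succ, hb', sub_sub]
      rw [Fin.succ_zero_eq_one]
      ring
    have e2 : ∀ x : ℝ, ∫⁻ v : Fin q → ℝ, ∏ i, posPow (b i) (baryCoord c
        ((MeasurableEquiv.piFinSuccAbove (fun _ : Fin (q + 1) => ℝ) 0).symm (x, v)) i) =
        ENNReal.ofReal ((∏ i, Real.Gamma (b' i)) / Real.Gamma (∑ i, b' i)) *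
          (posPow (b 1) x * posPow (∑ i, b' i) (c - x)) := by
      intro x
      simp_rw [e]
      rw [lintegral_const_mul _ (by fun_prop), ih b' hb'pos]
      ring
    have hs' : 0 < ∑ i, b' i := Finset.sum_pos (fun i _ => hb'pos i) Finset.univ_nonempty
    have hsum : ∑ i, b i = b 1 + ∑ i, b' i := by
      rw [Fin.sum_univ_succ, Fin.sum_univ_succ, Fin.sum_univ_succ b']
      simp only [hb', Fin.cons_zero, Fin.cons_succ, Fin.succ_zero_eq_one]
      ring
    have hprod : ∏ i, Real.Gamma (b i) = Real.Gamma (b 1) * ∏ i, Real.Gamma (b' i) := by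
      rw [Fin.prod_univ_succ, Fin.prod_univ_succ, Fin.prod_univ_succ (fun i => Real.Gamma (b' i))]
      simp only [hb', Fin.cons_zero, Fin.cons_succ, Fin.succ_zero_eq_one]
      ring
    refine (lintegral_congr e2).trans ?_
    rw [lintegral_const_mul _ (by fun_prop), lintegral_posPow_mul_posPow (hb 1) hs', ← mul_assoc,
      ← ENNReal.ofReal_mul (div_nonneg
        (Finset.prod_nonneg fun i _ => (Real.Gamma_pos_of_pos (hb'pos i)).le)
        (Real.Gamma_pos_of_pos hs').le), hsum, hprod]
    congr 2
    unfold ProbabilityTheory.beta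
    have := (Real.Gamma_pos_of_pos hs').ne'
    field_simp

theorem Gamma_add_nat {b : ℝ} (hb : 0 < b) (m : ℕ) :
    Real.Gamma (b + m) = poch b m * Real.Gamma b := by
  induction m with
  | zero => simp [poch_zero]
  | succ m ih =>
    push_cast
    rw [← add_assoc, Real.Gamma_add_one (by positivity), ih, poch_succ]
    ring

open PowerSeries in
theorem coeff_prod_eq_sum_piAntidiag {ι : Type*} [Fintype ι] [DecidableEq ι] (f : ι → ℝ⟦X⟧) (N : ℕ) :
    coeff N (∏ i, f i) = ∑ κ ∈ Finset.piAntidiag Finset.univ N, ∏ i, coeff (κ i) (f i) := by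
  rw [coeff_prod]
  refine Finset.sum_nbij' (fun l => ⇑l) (fun κ => Finsupp.equivFunOnFinite.symm κ) ?_ ?_ ?_ ?_ ?_
  · intro l hl
    simpa using (Finset.mem_finsuppAntidiag.1 hl).1
  · intro κ hκ
    simpa using (Finset.mem_piAntidiag.1 hκ).1
  · intro l _
    ext
    simp
  · intro κ _
    rfl
  · intro l _
    rfl

open PowerSeries in
/-- The moments of linear forms under the Dirichlet distribution. -/
theorem lintegral_prod_posPow_mul_pow {q : ℕ} {k : ℝ} (hk : 0 < k) {a : Fin (q + 1) → ℝ}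
    (ha : ∀ i, 0 ≤ a i) (m : ℕ) :
    ∫⁻ u : Fin q → ℝ, (∏ i, posPow k (baryCoord 1 u i)) *
        ENNReal.ofReal ((∑ i, a i * baryCoord 1 u i) ^ m) =
      ENNReal.ofReal (Real.Gamma k ^ (q + 1) / Real.Gamma ((q + 1) * k) *
        (m.factorial / poch ((q + 1) * k) m) * coeff m (∏ i, negBinomial k (a i))) := by
  have hexp : ∀ v : Fin (q + 1) → ℝ, (∏ i, posPow k (v i)) *
      ENNReal.ofReal ((∑ i, a i * v i) ^ m) =
      ∑ κ ∈ Finset.piAntidiag Finset.univ m,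
        ENNReal.ofReal (Nat.multinomial Finset.univ κ * ∏ i, a i ^ κ i) *
          ∏ i, posPow (k + κ i) (v i) := by
    intro v
    by_cases hv : ∀ i, 0 < v i
    · rw [Finset.sum_pow_eq_sum_piAntidiag, ENNReal.ofReal_sum_of_nonneg, Finset.mul_sum]
      · refine Finset.sum_congr rfl fun κ _ => ?_
        simp_rw [← posPow_mul_pow, Finset.prod_mul_distrib, mul_pow]
        rw [← ENNReal.ofReal_prod_of_nonneg fun i _ => pow_nonneg (hv i).le _,
          Finset.prod_mul_distrib, ← mul_assoc, ENNReal.ofReal_mul]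
        · ring
        · exact mul_nonneg (Nat.cast_nonneg _) (Finset.prod_nonneg fun i _ => pow_nonneg (ha i) _)
      · intro κ _
        exact mul_nonneg (Nat.cast_nonneg _)
          (Finset.prod_nonneg fun i _ => pow_nonneg (mul_nonneg (ha i) (hv i).le) _)
    · push Not at hv
      obtain ⟨i, hi⟩ := hv
      rw [Finset.prod_eq_zero (Finset.mem_univ i) (posPow_of_nonpos k hi), zero_mul]
      symm
      refine Finset.sum_eq_zero fun κ _ => ?_
      exact mul_eq_zero_of_right _ (Finset.prod_eq_zero (Finset.mem_univ i) (posPow_of_nonpos _ hi))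
  simp_rw [hexp]
  rw [lintegral_finsetSum _ fun κ _ => by fun_prop, coeff_prod_eq_sum_piAntidiag, Finset.mul_sum,
    ENNReal.ofReal_sum_of_nonneg]
  · refine Finset.sum_congr rfl fun κ hκ => ?_
    have hκ' : ∑ i, κ i = m := (Finset.mem_piAntidiag.1 hκ).1
    have hs : ∑ i, (k + κ i) = (q + 1) * k + m := by
      rw [Finset.sum_add_distrib, ← Nat.cast_sum, hκ']
      simp
    have hk' : 0 < (q + 1) * k := by positivity
    rw [lintegral_const_mul _ (by fun_prop), lintegral_prod_posPow _ fun i => by positivity,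
      posPow_one, mul_one, hs, Gamma_add_nat hk', ← ENNReal.ofReal_mul]
    · congr 1
      have h1 : (∏ i, (κ i).factorial : ℝ) * Nat.multinomial Finset.univ κ = m.factorial := by
        rw [← hκ']
        exact_mod_cast Nat.multinomial_spec Finset.univ κ
      have h2 : (∏ i, (κ i).factorial : ℝ) ≠ 0 :=
        Finset.prod_ne_zero_iff.2 fun i _ => by positivity
      have h3 := (poch_pos hk' m).ne'
      have h4 := (Real.Gamma_pos_of_pos hk').ne'
      simp_rw [Gamma_add_nat hk, coeff_negBinomial, Finset.prod_mul_distrib, Finset.prod_div_distrib]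
      rw [Finset.prod_const, Finset.card_univ, Fintype.card_fin, ← h1]
      field_simp
    · exact mul_nonneg (Nat.cast_nonneg _) (Finset.prod_nonneg fun i _ => pow_nonneg (ha i) _)
  · intro κ _
    have hk' : 0 < (q + 1) * k := by positivity
    have h3 := (poch_pos hk' m).le
    have h4 := (Real.Gamma_pos_of_pos hk').le
    have h5 := (Real.Gamma_pos_of_pos hk).le
    refine mul_nonneg (by positivity) (Finset.prod_nonneg fun i _ => ?_)
    rw [coeff_negBinomial]
    have := poch_nonneg hk.le (κ i)
    have := ha i
    positivity

end

noncomputable section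

open scoped ENNReal

theorem poch_two_mul (a : ℝ) (m : ℕ) :
    poch (2 * a) (2 * m) = 4 ^ m * poch a m * poch (a + 1 / 2) m := by
  induction m with
  | zero => simp [poch_zero]
  | succ m ih =>
    rw [show 2 * (m + 1) = 2 * m + 1 + 1 by ring, poch_succ, poch_succ, ih, poch_succ, poch_succ]
    push_cast
    ring

theorem poch_one (m : ℕ) : poch 1 m = m.factorial := ascPochhammer_eval_one ℝ m

theorem lintegral_comp_neg_real (f : ℝ → ℝ≥0∞) : ∫⁻ x, f (-x) = ∫⁻ x, f x :=
  (Measure.measurePreserving_neg (volume : Measure ℝ)).lintegral_comp_emb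
    (MeasurableEquiv.neg ℝ).measurableEmbedding f

theorem lintegral_comp_sq {g : ℝ → ℝ≥0∞} (hg : Measurable g) :
    ∫⁻ v : ℝ, g (v ^ 2) = ∫⁻ s, posPow (1 / 2) s * g s := by
  have himg : (fun v : ℝ => v ^ 2) '' Set.Ioi 0 = Set.Ioi 0 := by
    ext s
    constructor
    · rintro ⟨v, hv, rfl⟩
      exact pow_pos (Set.mem_Ioi.1 hv) 2
    · intro hs
      exact ⟨Real.sqrt s, Real.sqrt_pos.2 hs, Real.sq_sqrt (Set.mem_Ioi.1 hs).le⟩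
  have h1 : ∫⁻ s, posPow (1 / 2) s * g s = 2 * ∫⁻ v in Set.Ioi (0 : ℝ), g (v ^ 2) := by
    have h2 : ∫⁻ s, posPow (1 / 2) s * g s = ∫⁻ s in Set.Ioi (0 : ℝ), posPow (1 / 2) s * g s := by
      rw [← lintegral_indicator measurableSet_Ioi]
      congr 1
      funext s
      by_cases hs : s ∈ Set.Ioi (0 : ℝ)
      · rw [Set.indicator_of_mem hs]
      · rw [Set.indicator_of_notMem hs, posPow_of_nonpos _ (not_lt.1 hs), zero_mul]
    rw [h2]
    conv_lhs => rw [← himg]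
    rw [lintegral_image_eq_lintegral_abs_deriv_mul measurableSet_Ioi
      (f' := fun v => 2 * v) (fun v _ => by simpa using (hasDerivAt_pow 2 v).hasDerivWithinAt)
      (fun x hx y hy h => (sq_eq_sq₀ (Set.mem_Ioi.1 hx).le (Set.mem_Ioi.1 hy).le).1 h),
      ← lintegral_const_mul _ (by fun_prop)]
    refine setLIntegral_congr_fun measurableSet_Ioi fun v hv => ?_
    have hv' : 0 < v := hv
    rw [posPow_of_pos _ (by positivity), ← mul_assoc, ← ENNReal.ofReal_mul (by positivity),
      abs_of_pos (by positivity), ← Real.rpow_natCast_mul hv'.le]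
    congr 1
    rw [show ((2 : ℕ) : ℝ) * (1 / 2 - 1) = -1 by norm_num, Real.rpow_neg_one, mul_assoc,
      mul_inv_cancel₀ hv'.ne', mul_one, ENNReal.ofReal_ofNat]
  have h3 : ∫⁻ v : ℝ, g (v ^ 2) = (∫⁻ v in Set.Iic (0 : ℝ), g (v ^ 2)) +
      ∫⁻ v in Set.Ioi (0 : ℝ), g (v ^ 2) := by
    rw [← lintegral_add_compl _ (measurableSet_Iic (a := (0 : ℝ))), Set.compl_Iic]
  have h4 : ∫⁻ v in Set.Iic (0 : ℝ), g (v ^ 2) = ∫⁻ v in Set.Ioi (0 : ℝ), g (v ^ 2) := by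
    rw [setLIntegral_congr (Iio_ae_eq_Iic (a := (0 : ℝ))).symm, ← lintegral_indicator measurableSet_Iio,
      ← lintegral_indicator measurableSet_Ioi, ← lintegral_comp_neg_real]
    congr 1
    funext v
    simp [Set.indicator]
  rw [h1, h3, h4, two_mul]

theorem lintegral_posPow_sub_sq {b : ℝ} (hb : 0 < b) (a : ℝ) :
    ∫⁻ v : ℝ, posPow b (a - v ^ 2) =
      ENNReal.ofReal (ProbabilityTheory.beta (1 / 2) b) * posPow (b + 1 / 2) a := by
  rw [lintegral_comp_sq (g := fun s => posPow b (a - s)) (by fun_prop),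
    lintegral_posPow_mul_posPow one_half_pos hb, add_comm b]

theorem lintegral_sq_pow_mul_posPow {b : ℝ} (hb : 0 < b) (m : ℕ) :
    ∫⁻ x : ℝ, ENNReal.ofReal ((x ^ 2) ^ m) * posPow b (1 - x ^ 2) =
      ENNReal.ofReal (ProbabilityTheory.beta (1 / 2 + m) b) := by
  rw [lintegral_comp_sq (g := fun s => ENNReal.ofReal (s ^ m) * posPow b (1 - s)) (by fun_prop)]
  simp_rw [← mul_assoc, posPow_mul_pow]
  rw [lintegral_posPow_mul_posPow (by positivity) hb, posPow_one, mul_one]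

theorem lintegral_exp_mul_posPow {b : ℝ} (hb : 0 < b) (t : ℝ) :
    ∫⁻ x : ℝ, ENNReal.ofReal (Real.exp (t * x)) * posPow b (1 - x ^ 2) =
      ∑' m : ℕ, ENNReal.ofReal ((t ^ 2) ^ m / (2 * m).factorial *
        ProbabilityTheory.beta (1 / 2 + m) b) := by
  have hcosh : ∫⁻ x : ℝ, ENNReal.ofReal (Real.exp (t * x)) * posPow b (1 - x ^ 2) =
      ∫⁻ x : ℝ, ENNReal.ofReal (Real.cosh (t * x)) * posPow b (1 - x ^ 2) := by
    have h1 := lintegral_comp_neg_real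
      fun x => ENNReal.ofReal (Real.exp (t * x)) * posPow b (1 - x ^ 2)
    have h2 : ∀ x : ℝ, ENNReal.ofReal (Real.exp (t * x)) * posPow b (1 - x ^ 2) +
        ENNReal.ofReal (Real.exp (t * -x)) * posPow b (1 - (-x) ^ 2) =
        2 * (ENNReal.ofReal (Real.cosh (t * x)) * posPow b (1 - x ^ 2)) := by
      intro x
      rw [neg_sq, ← add_mul, ← ENNReal.ofReal_add (Real.exp_pos _).le (Real.exp_pos _).le,
        ← mul_assoc, ← ENNReal.ofReal_ofNat, ← ENNReal.ofReal_mul zero_le_two, Real.cosh_eq,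
        mul_neg]
      congr 2
      ring
    have h3 : 2 * ∫⁻ x : ℝ, ENNReal.ofReal (Real.exp (t * x)) * posPow b (1 - x ^ 2) =
        2 * ∫⁻ x : ℝ, ENNReal.ofReal (Real.cosh (t * x)) * posPow b (1 - x ^ 2) := by
      rw [two_mul]
      nth_rewrite 2 [← h1]
      rw [← lintegral_add_left (by fun_prop), ← lintegral_const_mul _ (by fun_prop)]
      exact lintegral_congr h2
    exact (ENNReal.mul_right_inj two_ne_zero ENNReal.ofNat_ne_top).1 h3
  have hser : ∀ x : ℝ, ENNReal.ofReal (Real.cosh (t * x)) * posPow b (1 - x ^ 2) =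
      ∑' m : ℕ, ENNReal.ofReal ((t ^ 2) ^ m / (2 * m).factorial) *
        (ENNReal.ofReal ((x ^ 2) ^ m) * posPow b (1 - x ^ 2)) := by
    intro x
    have h1 := Real.hasSum_cosh (t * x)
    rw [← h1.tsum_eq, ENNReal.ofReal_tsum_of_nonneg _ h1.summable, ← ENNReal.tsum_mul_right]
    · congr 1
      funext m
      rw [← mul_assoc, ← ENNReal.ofReal_mul (by positivity)]
      congr 2
      rw [pow_mul, mul_pow, mul_pow]
      ring
    · intro m
      rw [pow_mul]
      positivity
  rw [hcosh, lintegral_congr hser, lintegral_tsum fun m => by fun_prop]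
  congr 1
  funext m
  rw [lintegral_const_mul _ (by fun_prop), lintegral_sq_pow_mul_posPow hb,
    ← ENNReal.ofReal_mul (by positivity)]

/-- The Laplace transform of `(1 - |w|²)^{b-1}` on the unit disc is a modified Bessel function. -/
theorem lintegral_exp_mul_posPow_disc {b : ℝ} (hb : 0 < b) (t : ℝ) :
    ∫⁻ w : ℂ, ENNReal.ofReal (Real.exp (t * w.re)) * posPow b (1 - w.re ^ 2 - w.im ^ 2) =
      ∑' m : ℕ, ENNReal.ofReal (Real.pi / b *
        ((t ^ 2) ^ m / (4 ^ m * m.factorial * poch (b + 1) m))) := by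
  rw [← Complex.volume_preserving_equiv_real_prod.symm.lintegral_comp (by fun_prop),
    Measure.volume_eq_prod, lintegral_prod _ (by
      simp only [Complex.measurableEquivRealProd_symm_apply]
      fun_prop)]
  simp only [Complex.measurableEquivRealProd_symm_apply]
  have h1 : ∀ x : ℝ, ∫⁻ v : ℝ, ENNReal.ofReal (Real.exp (t * x)) * posPow b (1 - x ^ 2 - v ^ 2) =
      ENNReal.ofReal (ProbabilityTheory.beta (1 / 2) b) *
        (ENNReal.ofReal (Real.exp (t * x)) * posPow (b + 1 / 2) (1 - x ^ 2)) := by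
    intro x
    rw [lintegral_const_mul _ (by fun_prop), lintegral_posPow_sub_sq hb]
    ring
  rw [lintegral_congr h1, lintegral_const_mul _ (by fun_prop),
    lintegral_exp_mul_posPow (by positivity), ← ENNReal.tsum_mul_left]
  congr 1
  funext m
  rw [← ENNReal.ofReal_mul (ProbabilityTheory.beta_pos one_half_pos hb).le]
  congr 1
  have hf : ((2 * m).factorial : ℝ) = 4 ^ m * poch (1 / 2) m * m.factorial := by
    rw [← poch_one, ← poch_one, show (1 : ℝ) = 2 * (1 / 2) by norm_num, poch_two_mul]
    norm_num
  have hp := (poch_pos (one_half_pos (α := ℝ)) m).ne'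
  have hp' := (poch_pos (show 0 < b + 1 by positivity) m).ne'
  unfold ProbabilityTheory.beta
  rw [hf, Gamma_add_nat one_half_pos, show 1 / 2 + (m : ℝ) + (b + 1 / 2) = b + 1 + m by ring,
    Gamma_add_nat (by positivity), Real.Gamma_add_one hb.ne', Real.Gamma_one_half_eq,
    add_comm (1 / 2 : ℝ) b]
  have g1 := (Real.Gamma_pos_of_pos hb).ne'
  have g2 := (Real.Gamma_pos_of_pos (show 0 < b + 1 / 2 by positivity)).ne'
  field_simp
  rw [Real.sq_sqrt Real.pi_pos.le, mul_comm]

end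

noncomputable section

open scoped ENNReal

@[fun_prop]
theorem measurable_complex_mk {α : Type*} [MeasurableSpace α] {f g : α → ℝ} (hf : Measurable f)
    (hg : Measurable g) : Measurable fun x => (⟨f x, g x⟩ : ℂ) :=
  Complex.measurableEquivRealProd.symm.measurable.comp (hf.prodMk hg)

theorem lintegral_complex_eq {g : ℂ → ℝ≥0∞} (hg : Measurable g) :
    ∫⁻ z, g z = ∫⁻ x : ℝ, ∫⁻ v : ℝ, g ⟨x, v⟩ := by
  rw [← Complex.volume_preserving_equiv_real_prod.symm.lintegral_comp hg, Measure.volume_eq_prod]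
  exact lintegral_prod (fun x : ℝ × ℝ => g ⟨x.1, x.2⟩)
    (hg.comp (by fun_prop : Measurable fun x : ℝ × ℝ => (⟨x.1, x.2⟩ : ℂ))).aemeasurable

theorem lintegral_complex_triangular {f : ℂ → ℝ≥0∞} (hf : Measurable f) {p r : ℝ} (hp : 0 < p)
    (hr : 0 < r) (q : ℝ) :
    ∫⁻ z, f z = ENNReal.ofReal (p * r) * ∫⁻ w : ℂ, f ⟨p * w.re, r * w.im + q * w.re⟩ := by
  have hF : Measurable fun x : ℝ => ∫⁻ v : ℝ, f ⟨x, v⟩ :=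
    Measurable.lintegral_prod_right' (f := fun x : ℝ × ℝ => f ⟨x.1, x.2⟩) (by fun_prop)
  have hG : Measurable fun x : ℝ => ∫⁻ v : ℝ, f ⟨p * x, r * v + q * x⟩ :=
    Measurable.lintegral_prod_right' (f := fun x : ℝ × ℝ => f ⟨p * x.1, r * x.2 + q * x.1⟩)
      (by fun_prop)
  have h1 : ∀ x : ℝ, ∫⁻ v : ℝ, f ⟨p * x, v⟩ =
      ENNReal.ofReal r * ∫⁻ v : ℝ, f ⟨p * x, r * v + q * x⟩ := by
    intro x
    rw [← lintegral_add_right_eq_self _ (q * x),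
      lintegral_eq_mul_lintegral_comp_mul hr (f := fun v => f ⟨p * x, v + q * x⟩) (by fun_prop)]
  rw [lintegral_complex_eq hf, lintegral_complex_eq (by fun_prop),
    lintegral_eq_mul_lintegral_comp_mul hp hF, lintegral_congr h1, lintegral_const_mul _ hG,
    ← mul_assoc, ← ENNReal.ofReal_mul hp.le]

theorem lintegral_complex_mul_left (f : ℂ → ℝ≥0∞) {e : ℂ} (he : ‖e‖ = 1) :
    ∫⁻ w, f (e * w) = ∫⁻ w, f w := by
  set R := rotation (⟨e, by simpa [Submonoid.unitSphere] using he⟩ : Circle)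
  exact R.measurePreserving.lintegral_comp_emb R.toHomeomorph.measurableEmbedding f

/-- The Laplace transform of `(1 - |w|²)^{s-1}`, transported to an ellipse. -/
theorem lintegral_exp_mul_posPow_ellipse {s : ℝ} (hs : 0 < s) {a c ρ : ℝ} (ha : 0 < a) (hc : 0 < c)
    (hρ : 0 < ρ) (b : ℝ) (y : ℂ) :
    ∫⁻ z : ℂ, ENNReal.ofReal (Real.exp (inner ℝ y z)) *
        (ENNReal.ofReal (a * c * (2 / (ρ ^ 2 * a ^ 2 * c ^ 2)) ^ s) *
          posPow s (ρ ^ 2 * a ^ 2 * c ^ 2 / 2 - (c * z.re) ^ 2 - (a * z.im - b * z.re) ^ 2)) =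
      ∑' m : ℕ, ENNReal.ofReal (Real.pi / s *
        ((ρ ^ 2 / 2 * ((a * y.re + b * y.im) ^ 2 + (c * y.im) ^ 2)) ^ m /
          (4 ^ m * m.factorial * poch (s + 1) m))) := by
  set σ := ρ / Real.sqrt 2 with hσ
  have hσpos : 0 < σ := by positivity
  have hσ2 : σ ^ 2 = ρ ^ 2 / 2 := by rw [hσ, div_pow, Real.sq_sqrt zero_le_two]
  clear_value σ
  set η : ℂ := ⟨σ * (a * y.re + b * y.im), σ * (c * y.im)⟩ with hη
  obtain ⟨e, he, heη⟩ : ∃ e : ℂ, ‖e‖ = 1 ∧ starRingEnd ℂ η * e = ‖η‖ := by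
    by_cases h : η = 0
    · exact ⟨1, by simp, by simp [h]⟩
    · have h' : ‖η‖ ≠ 0 := norm_ne_zero_iff.2 h
      refine ⟨η / ‖η‖, by simp [h'], ?_⟩
      rw [mul_div_assoc', mul_comm, Complex.mul_conj, Complex.normSq_eq_norm_sq, div_eq_iff (by
        exact_mod_cast h')]
      push_cast
      ring
  have hT : ‖η‖ ^ 2 = ρ ^ 2 / 2 * ((a * y.re + b * y.im) ^ 2 + (c * y.im) ^ 2) := by
    rw [← Complex.normSq_eq_norm_sq, Complex.normSq_apply, ← hσ2, hη]
    ring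
  rw [← hT, ← lintegral_exp_mul_posPow_disc hs,
    lintegral_complex_triangular (by fun_prop) (mul_pos hσpos ha) (mul_pos hσpos hc) (σ * b),
    ← lintegral_complex_mul_left _ he, ← lintegral_const_mul _ (by fun_prop)]
  refine lintegral_congr fun w => ?_
  have hin : inner ℝ y (⟨σ * a * (e * w).re, σ * c * (e * w).im + σ * b * (e * w).re⟩ : ℂ) =
      ‖η‖ * w.re := by
    have h1 : (starRingEnd ℂ η * (e * w)).re = ‖η‖ * w.re := by
      rw [← mul_assoc, heη, Complex.re_ofReal_mul]
    rw [← h1, Complex.inner]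
    generalize e * w = v
    simp only [hη, Complex.mul_re, Complex.conj_re, Complex.conj_im]
    ring
  have hnorm : (e * w).re ^ 2 + (e * w).im ^ 2 = w.re ^ 2 + w.im ^ 2 := by
    have h1 : Complex.normSq (e * w) = Complex.normSq w := by
      rw [Complex.normSq_eq_norm_sq, norm_mul, he, one_mul, Complex.normSq_eq_norm_sq]
    simp only [Complex.normSq_apply] at h1
    linarith
  set K := ρ ^ 2 * a ^ 2 * c ^ 2 / 2 with hK
  have hKpos : 0 < K := by positivity
  have harg : K - (c * (σ * a * (e * w).re)) ^ 2 -
      (a * (σ * c * (e * w).im + σ * b * (e * w).re) - b * (σ * a * (e * w).re)) ^ 2 =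
      K * (1 - w.re ^ 2 - w.im ^ 2) := by
    rw [sub_sub 1, ← hnorm, hK]
    linear_combination (-(a ^ 2 * c ^ 2 * ((e * w).re ^ 2 + (e * w).im ^ 2))) * hσ2
  rw [hin]
  simp only
  rw [harg, posPow_mul_left _ hKpos]
  have h2 : 2 / (ρ ^ 2 * a ^ 2 * c ^ 2) = K⁻¹ := by
    rw [hK, inv_div]
  clear_value K
  have hone : σ * a * (σ * c) * (a * c * K⁻¹ ^ s * K ^ (s - 1)) = 1 := by
    rw [Real.rpow_sub_one hKpos.ne', Real.inv_rpow hKpos.le]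
    have := (Real.rpow_pos_of_pos hKpos s).ne'
    field_simp
    rw [hK]
    linear_combination (a ^ 2 * c ^ 2) * hσ2
  rw [h2]
  calc _ = ENNReal.ofReal (σ * a * (σ * c) * (a * c * K⁻¹ ^ s * K ^ (s - 1))) *
        (ENNReal.ofReal (Real.exp (‖η‖ * w.re)) * posPow s (1 - w.re ^ 2 - w.im ^ 2)) := by
        have h3 : ENNReal.ofReal (σ * a * (σ * c) * (a * c * K⁻¹ ^ s * K ^ (s - 1))) =
            ENNReal.ofReal (σ * a * (σ * c)) *
              (ENNReal.ofReal (a * c * K⁻¹ ^ s) * ENNReal.ofReal (K ^ (s - 1))) := by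
          rw [ENNReal.ofReal_mul (p := σ * a * (σ * c)) (by positivity),
            ENNReal.ofReal_mul (p := a * c * K⁻¹ ^ s) (by positivity)]
        rw [h3]
        ring
    _ = _ := by rw [hone, ENNReal.ofReal_one, one_mul]

section Simplex

variable {p : ℕ}

theorem simplexZero_eq_baryCoord (u : Fin (p - 1) → ℝ) : simplexZero u = baryCoord 1 u 0 := rfl

theorem sum_baryCoord {q : ℕ} (c : ℝ) (u : Fin q → ℝ) : ∑ i, baryCoord c u i = c := by
  simp [baryCoord, Fin.sum_univ_succ]

theorem ae_baryCoord_ne_zero {q : ℕ} (hq : 0 < q) :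
    ∀ᵐ u : Fin q → ℝ, ∀ i, baryCoord 1 u i ≠ 0 := by
  rw [ae_all_iff]
  intro i
  cases i using Fin.cases with
  | zero =>
    set S : AffineSubspace ℝ (Fin q → ℝ) := AffineSubspace.mk' (fun _ => (q : ℝ)⁻¹)
      (LinearMap.ker (∑ i, LinearMap.proj (R := ℝ) (φ := fun _ : Fin q => ℝ) i)) with hS
    have hq' : (q : ℝ) ≠ 0 := by positivity
    have hmem : ∀ u, u ∈ S ↔ ∑ i, u i = 1 := by
      intro u
      rw [hS, AffineSubspace.mem_mk', LinearMap.mem_ker]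
      simp [Finset.sum_sub_distrib, hq', sub_eq_zero]
    have hne : S ≠ ⊤ := by
      intro h
      have h0 : (0 : Fin q → ℝ) ∈ S := h ▸ AffineSubspace.mem_top ℝ _ _
      rw [hmem] at h0
      simp at h0
    have h1 := Measure.addHaar_affineSubspace (volume : Measure (Fin q → ℝ)) S hne
    refine measure_mono_null (fun u hu => ?_) h1
    simp only [baryCoord, Fin.cons_zero, Set.mem_compl_iff, Set.mem_ofPred_eq, not_not] at hu
    exact (hmem u).2 (by linarith)
  | succ i =>
    have h1 := Measure.pi_hyperplane (fun _ : Fin q => (volume : Measure ℝ)) i 0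
    exact measure_mono_null (fun u hu => by simpa [baryCoord] using hu) h1

theorem sumA_add_simplexZero (u : Fin (p - 1) → ℝ) :
    simplexZero u + sumA u = ∑ i, baryCoord 1 u i * Real.cos (2 * (i : ℕ) * Real.pi / p) := by
  rw [Fin.sum_univ_succ]
  simp [sumA, simplexZero, baryCoord]

theorem sumB_eq (u : Fin (p - 1) → ℝ) :
    sumB u = -∑ i, baryCoord 1 u i * Real.sin (2 * (i : ℕ) * Real.pi / p) := by
  rw [Fin.sum_univ_succ]
  simp [sumB, baryCoord]

theorem sq_add_sq_lt_one (hp : 2 ≤ p) {u : Fin (p - 1) → ℝ} (hu : ∀ i, 0 < baryCoord 1 u i) :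
    (simplexZero u + sumA u) ^ 2 + sumB u ^ 2 < 1 := by
  have hu0 : 0 < simplexZero u := hu 0
  have hui : ∀ i, 0 < u i := fun i => hu i.succ
  have hp' : (0 : ℝ) < p := by positivity
  have hA : sumA u < ∑ i, u i := by
    unfold sumA
    have : Nonempty (Fin (p - 1)) := ⟨⟨0, by omega⟩⟩
    refine Finset.sum_lt_sum_of_nonempty Finset.univ_nonempty fun i _ => ?_
    have h1 : ((i : ℝ) + 1) < p := by
      have := i.2
      exact_mod_cast (show (i : ℕ) + 1 < p by omega)
    have h2 : 0 < 2 * ((i : ℝ) + 1) * Real.pi / p := by positivity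
    have h3 : 2 * ((i : ℝ) + 1) * Real.pi / p < 2 * Real.pi := by
      rw [div_lt_iff₀ hp']
      nlinarith [Real.pi_pos]
    have h4 : Real.cos (2 * ((i : ℝ) + 1) * Real.pi / p) < 1 := by
      refine lt_of_le_of_ne (Real.cos_le_one _) fun h => ?_
      rw [Real.cos_eq_one_iff_of_lt_of_lt (by linarith [Real.pi_pos]) h3] at h
      exact h2.ne' h
    nlinarith [hui i]
  have hAB : sumA u ^ 2 + sumB u ^ 2 ≤ (∑ i, u i) ^ 2 := by
    have h1 : sumA u ^ 2 ≤ (∑ i, u i) *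
        ∑ i, u i * Real.cos (2 * ((i : ℝ) + 1) * Real.pi / p) ^ 2 := by
      refine Finset.sum_sq_le_sum_mul_sum_of_sq_le_mul _ (fun i _ => (hui i).le)
        (fun i _ => mul_nonneg (hui i).le (sq_nonneg _)) fun i _ => le_of_eq ?_
      ring
    have h2 : sumB u ^ 2 ≤ (∑ i, u i) *
        ∑ i, u i * Real.sin (2 * ((i : ℝ) + 1) * Real.pi / p) ^ 2 := by
      refine Finset.sum_sq_le_sum_mul_sum_of_sq_le_mul _ (fun i _ => (hui i).le)
        (fun i _ => mul_nonneg (hui i).le (sq_nonneg _)) fun i _ => le_of_eq ?_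
      ring
    have h3 : (∑ i, u i * Real.cos (2 * ((i : ℝ) + 1) * Real.pi / p) ^ 2) +
        ∑ i, u i * Real.sin (2 * ((i : ℝ) + 1) * Real.pi / p) ^ 2 = ∑ i, u i := by
      rw [← Finset.sum_add_distrib]
      refine Finset.sum_congr rfl fun i _ => ?_
      rw [← mul_add, Real.cos_sq_add_sin_sq, mul_one]
    calc _ ≤ _ := add_le_add h1 h2
      _ = _ := by rw [← mul_add, h3, sq]
  have hsum : ∑ i, u i = 1 - simplexZero u := by simp [simplexZero]
  rw [hsum] at hA hAB
  nlinarith [mul_pos hu0 (sub_pos.2 hA)]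

theorem coeffA_pos (hp : 2 ≤ p) {u : Fin (p - 1) → ℝ} (hu : ∀ i, 0 < baryCoord 1 u i) :
    0 < coeffA u := by
  have h := sq_add_sq_lt_one hp hu
  refine Real.sqrt_pos.2 ?_
  nlinarith [sq_nonneg (sumB u)]

theorem coeffC_pos (hp : 2 ≤ p) {u : Fin (p - 1) → ℝ} (hu : ∀ i, 0 < baryCoord 1 u i) :
    0 < coeffC u := by
  have h := sq_add_sq_lt_one hp hu
  have h1 := coeffA_pos hp hu
  have h2 : 0 < Real.sqrt (1 - (simplexZero u + sumA u) ^ 2 - sumB u ^ 2) :=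
    Real.sqrt_pos.2 (by linarith)
  unfold coeffC
  positivity

/-- The quadratic form of the ellipse attached to `u` is the barycentre of the squared functionals
`⟨ρ τ, y⟩²` over half of the orbit of `ρ`. -/
theorem quadraticForm_eq_sum (hp : 2 ≤ p) {u : Fin (p - 1) → ℝ} (hu : ∀ i, 0 < baryCoord 1 u i)
    (ρ : ℝ) (y : ℂ) :
    ρ ^ 2 / 2 * ((coeffA u * y.re + coeffB u * y.im) ^ 2 + (coeffC u * y.im) ^ 2) =
      ∑ i : Fin (p - 1 + 1), (ρ * inner ℝ
        ((Complex.exp (2 * Real.pi * Complex.I / (2 * p : ℕ)))⁻¹ ^ (i : ℕ)) y) ^ 2 *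
          baryCoord 1 u i := by
  have hlt := sq_add_sq_lt_one hp hu
  have hApos := coeffA_pos hp hu
  set Z := simplexZero u + sumA u with hZ
  have hA2 : coeffA u ^ 2 = 1 + Z := by
    rw [coeffA, Real.sq_sqrt]
    · ring
    · nlinarith [sq_nonneg (sumB u)]
  have hAB : coeffA u * coeffB u = sumB u := by
    unfold coeffB
    field_simp
  have hAC : (coeffA u * coeffC u) ^ 2 = 1 - Z ^ 2 - sumB u ^ 2 := by
    have : coeffA u * coeffC u = Real.sqrt (1 - Z ^ 2 - sumB u ^ 2) := by
      unfold coeffC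
      rw [← hZ]
      field_simp
    rw [this, Real.sq_sqrt (by linarith)]
  have hBC : coeffB u ^ 2 + coeffC u ^ 2 = 1 - Z := by
    have h1 : coeffA u ^ 2 * (coeffB u ^ 2 + coeffC u ^ 2) = coeffA u ^ 2 * (1 - Z) := by
      rw [mul_add, ← mul_pow, ← mul_pow, hAB, hAC, hA2]
      ring
    exact mul_left_cancel₀ (by positivity) h1
  have hp' : (p : ℝ) ≠ 0 := by positivity
  have hin : ∀ i : Fin (p - 1 + 1), inner ℝ
      ((Complex.exp (2 * Real.pi * Complex.I / (2 * p : ℕ)))⁻¹ ^ (i : ℕ)) y =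
      Real.cos ((i : ℕ) * Real.pi / p) * y.re - Real.sin ((i : ℕ) * Real.pi / p) * y.im := by
    intro i
    have h1 : (Complex.exp (2 * Real.pi * Complex.I / (2 * p : ℕ)))⁻¹ ^ (i : ℕ) =
        Complex.exp ((-((i : ℕ) * Real.pi / p) : ℝ) * Complex.I) := by
      rw [← Complex.exp_neg, ← Complex.exp_nat_mul]
      congr 1
      have : (p : ℂ) ≠ 0 := by exact_mod_cast hp'
      push_cast
      field_simp
    rw [h1, Complex.inner]
    simp only [Complex.mul_re, Complex.conj_re, Complex.conj_im, Complex.exp_ofReal_mul_I_re,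
      Complex.exp_ofReal_mul_I_im, Real.cos_neg, Real.sin_neg]
    ring
  have hterm : ∀ i : Fin (p - 1 + 1), (ρ * inner ℝ
      ((Complex.exp (2 * Real.pi * Complex.I / (2 * p : ℕ)))⁻¹ ^ (i : ℕ)) y) ^ 2 *
        baryCoord 1 u i =
      ρ ^ 2 / 2 * (y.re ^ 2 + y.im ^ 2) * baryCoord 1 u i +
      ρ ^ 2 / 2 * (y.re ^ 2 - y.im ^ 2) *
        (baryCoord 1 u i * Real.cos (2 * (i : ℕ) * Real.pi / p)) -
      ρ ^ 2 * (y.re * y.im) * (baryCoord 1 u i * Real.sin (2 * (i : ℕ) * Real.pi / p)) := by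
    intro i
    rw [hin, show 2 * ((i : ℕ) : ℝ) * Real.pi / p = 2 * ((i : ℕ) * Real.pi / p) by ring,
      Real.cos_two_mul, Real.sin_two_mul]
    have h1 := Real.sin_sq_add_cos_sq ((i : ℕ) * Real.pi / p)
    linear_combination (ρ ^ 2 * y.im ^ 2 * baryCoord 1 u i) * h1
  simp_rw [hterm]
  rw [Finset.sum_sub_distrib, Finset.sum_add_distrib, ← Finset.mul_sum, ← Finset.mul_sum,
    ← Finset.mul_sum, sum_baryCoord, ← sumA_add_simplexZero, ← hZ,
    show (∑ i, baryCoord 1 u i * Real.sin (2 * (i : ℕ) * Real.pi / p)) = -sumB u by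
      rw [sumB_eq, neg_neg]]
  linear_combination (ρ ^ 2 / 2 * y.re ^ 2) * hA2 + (ρ ^ 2 * y.re * y.im) * hAB +
    (ρ ^ 2 / 2 * y.im ^ 2) * hBC

end Simplex

end

noncomputable section

open scoped ENNReal

theorem coeff_prod_negBinomial_nonneg {ι : Type*} {k : ℝ} (hk : 0 ≤ k) (s : Finset ι) {a : ι → ℝ}
    (ha : ∀ i ∈ s, 0 ≤ a i) (m : ℕ) : 0 ≤ PowerSeries.coeff m (∏ i ∈ s, negBinomial k (a i)) := by
  classical
  rw [PowerSeries.coeff_prod]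
  refine Finset.sum_nonneg fun l _ => Finset.prod_nonneg fun i hi => ?_
  rw [coeff_negBinomial]
  have := poch_nonneg hk (l i)
  have := ha i hi
  positivity

theorem generalizedBessel_nonneg {p : ℕ} (hp : 0 < p) {k : ℝ} (hk : 0 < k) (ρ : ℝ) (y : ℂ) :
    0 ≤ generalizedBessel (2 * p) k (ρ : ℂ) y := by
  have hp' : (0 : ℝ) < p := by exact_mod_cast hp
  refine (hasSum_generalizedBessel hp hk ρ y
    (Complex.isPrimitiveRoot_exp (2 * p) (by omega))).nonneg fun m => ?_
  exact div_nonneg (coeff_prod_negBinomial_nonneg hk.le _ (fun _ _ => sq_nonneg _) m)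
    (poch_pos (by positivity) _).le

section Kernel

variable {p : ℕ}

@[fun_prop]
theorem measurable_simplexZero : Measurable (simplexZero : (Fin (p - 1) → ℝ) → ℝ) := by
  unfold simplexZero
  fun_prop

@[fun_prop]
theorem measurable_sumA : Measurable (sumA : (Fin (p - 1) → ℝ) → ℝ) := by
  unfold sumA
  fun_prop

@[fun_prop]
theorem measurable_sumB : Measurable (sumB : (Fin (p - 1) → ℝ) → ℝ) := by
  unfold sumB
  fun_prop

@[fun_prop]
theorem measurable_coeffA : Measurable (coeffA : (Fin (p - 1) → ℝ) → ℝ) := by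
  unfold coeffA
  fun_prop

@[fun_prop]
theorem measurable_coeffB : Measurable (coeffB : (Fin (p - 1) → ℝ) → ℝ) := by
  unfold coeffB
  fun_prop

@[fun_prop]
theorem measurable_coeffC : Measurable (coeffC : (Fin (p - 1) → ℝ) → ℝ) := by
  unfold coeffC
  fun_prop

theorem measurableSet_laplaceRegion_prod (p : ℕ) (ρ : ℝ) :
    MeasurableSet {x : ℂ × (Fin (p - 1) → ℝ) | x.2 ∈ laplaceRegion p ρ x.1} := by
  have h : {x : ℂ × (Fin (p - 1) → ℝ) | x.2 ∈ laplaceRegion p ρ x.1} =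
      ({x | 0 ≤ simplexZero x.2} ∩ ⋂ i, {x | 0 ≤ x.2 i}) ∩
        {x | (coeffC x.2 * x.1.re) ^ 2 + (coeffA x.2 * x.1.im - coeffB x.2 * x.1.re) ^ 2 <
          ρ ^ 2 * coeffA x.2 ^ 2 * coeffC x.2 ^ 2 / 2} := by
    ext x
    simp [laplaceRegion, stdSimplexCoord]
  rw [h]
  refine ((measurableSet_le measurable_const (by fun_prop)).inter
    (MeasurableSet.iInter fun i => measurableSet_le measurable_const (by fun_prop))).inter
      (measurableSet_lt (by fun_prop) (by fun_prop))

theorem measurableSet_laplaceRegion (p : ℕ) (ρ : ℝ) (z : ℂ) :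
    MeasurableSet (laplaceRegion p ρ z) :=
  (measurableSet_laplaceRegion_prod p ρ).preimage (measurable_prodMk_left (x := z))

/-- The joint density of the Laplace representation. -/
def laplaceDensity (p : ℕ) (k ρ : ℝ) (y : ℂ) (x : ℂ × (Fin (p - 1) → ℝ)) : ℝ :=
  Real.exp (inner ℝ y x.1) *
    (laplaceRegion p ρ x.1).indicator (laplaceIntegrand p k ρ x.1) x.2

theorem measurable_laplaceDensity (p : ℕ) (k ρ : ℝ) (y : ℂ) :
    Measurable (laplaceDensity p k ρ y) := by
  classical
  have h : laplaceDensity p k ρ y = fun x => Real.exp (inner ℝ y x.1) *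
      {x : ℂ × (Fin (p - 1) → ℝ) | x.2 ∈ laplaceRegion p ρ x.1}.indicator
        (fun x => laplaceIntegrand p k ρ x.1 x.2) x := rfl
  rw [h]
  refine Measurable.mul (by fun_prop) (Measurable.indicator ?_ (measurableSet_laplaceRegion_prod p ρ))
  unfold laplaceIntegrand
  fun_prop

theorem laplaceDensity_nonneg (p : ℕ) (k ρ : ℝ) (y : ℂ) (x : ℂ × (Fin (p - 1) → ℝ)) :
    0 ≤ laplaceDensity p k ρ y x := by
  refine mul_nonneg (Real.exp_pos _).le (Set.indicator_nonneg (fun u hu => ?_) _)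
  obtain ⟨⟨h0, hi⟩, h1⟩ := hu
  have hA : 0 ≤ coeffA u := Real.sqrt_nonneg _
  have hC : 0 ≤ coeffC u := mul_nonneg (by positivity) (Real.sqrt_nonneg _)
  have h2 : 0 ≤ ρ ^ 2 * coeffA u ^ 2 * coeffC u ^ 2 / 2 - (coeffC u * x.1.re) ^ 2 -
      (coeffA u * x.1.im - coeffB u * x.1.re) ^ 2 := by linarith
  have h3 : 0 ≤ ∏ i, u i ^ (k - 1) :=
    Finset.prod_nonneg fun i _ => Real.rpow_nonneg (hi i) _
  have h4 := Real.rpow_nonneg h0 (k - 1)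
  have h5 := Real.rpow_nonneg h2 ((p : ℝ) * k - 3 / 2)
  unfold laplaceIntegrand
  positivity

/-- Off the hyperplanes bounding the simplex, the joint density is a product of densities on
half-lines. -/
theorem ofReal_laplaceDensity (hp : 2 ≤ p) (k ρ : ℝ) (y z : ℂ) {u : Fin (p - 1) → ℝ}
    (hu : ∀ i, baryCoord 1 u i ≠ 0) :
    ENNReal.ofReal (laplaceDensity p k ρ y (z, u)) =
      (ENNReal.ofReal (Real.exp (inner ℝ y z)) *
        (ENNReal.ofReal (coeffA u * coeffC u *
            (2 / (ρ ^ 2 * coeffA u ^ 2 * coeffC u ^ 2)) ^ ((p : ℝ) * k - 1 / 2)) *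
          posPow ((p : ℝ) * k - 1 / 2) (ρ ^ 2 * coeffA u ^ 2 * coeffC u ^ 2 / 2 -
            (coeffC u * z.re) ^ 2 - (coeffA u * z.im - coeffB u * z.re) ^ 2))) *
        ∏ i, posPow k (baryCoord 1 u i) := by
  unfold laplaceDensity
  rw [ENNReal.ofReal_mul (Real.exp_pos _).le]
  by_cases hpos : ∀ i, 0 < baryCoord 1 u i
  · have hA := coeffA_pos hp hpos
    have hC := coeffC_pos hp hpos
    have hS : u ∈ stdSimplexCoord p := ⟨(hpos 0).le, fun i => (hpos i.succ).le⟩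
    by_cases hQ : 0 < ρ ^ 2 * coeffA u ^ 2 * coeffC u ^ 2 / 2 -
        (coeffC u * z.re) ^ 2 - (coeffA u * z.im - coeffB u * z.re) ^ 2
    · rw [Set.indicator_of_mem (show u ∈ laplaceRegion p ρ z from ⟨hS, by linarith⟩),
        posPow_of_pos _ hQ, Fin.prod_univ_succ, posPow_of_pos _ (hpos 0), mul_assoc]
      have h1 : ∀ i : Fin (p - 1), posPow k (baryCoord 1 u i.succ) =
          ENNReal.ofReal (u i ^ (k - 1)) := fun i => posPow_of_pos k (hpos i.succ)
      simp_rw [h1]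
      have hu0 : 0 ≤ baryCoord 1 u 0 := (hpos 0).le
      congr 1
      rw [← ENNReal.ofReal_prod_of_nonneg fun i _ => Real.rpow_nonneg (hpos i.succ).le _,
        ← ENNReal.ofReal_mul (by positivity), ← ENNReal.ofReal_mul (by positivity),
        ← ENNReal.ofReal_mul (by positivity)]
      congr 1
      unfold laplaceIntegrand
      rw [simplexZero_eq_baryCoord, show (p : ℝ) * k - 1 / 2 - 1 = p * k - 3 / 2 by ring]
    · rw [Set.indicator_of_notMem (fun h => hQ (by linarith [h.2])),
        posPow_of_nonpos _ (not_lt.1 hQ)]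
      simp
  · push Not at hpos
    obtain ⟨i, hi⟩ := hpos
    have hneg := lt_of_le_of_ne hi (hu i)
    rw [Finset.prod_eq_zero (Finset.mem_univ i) (posPow_of_nonpos k hi), mul_zero,
      Set.indicator_of_notMem]
    · simp
    · intro h
      have hall : ∀ j, 0 ≤ baryCoord 1 u j := fun j => by
        cases j using Fin.cases with
        | zero => exact h.1.1
        | succ j => exact h.1.2 j
      exact absurd (hall i) (not_le.2 hneg)

/-- The total mass of the joint density. -/
theorem lintegral_laplaceDensity (hp : 2 ≤ p) {k : ℝ} (hk : 1 / 2 < (p : ℝ) * k) {ρ : ℝ}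
    (hρ : 0 < ρ) (y : ℂ) :
    ∫⁻ x, ENNReal.ofReal (laplaceDensity p k ρ y x) =
      ENNReal.ofReal (Real.pi / (p * k - 1 / 2) * (Real.Gamma k ^ p / Real.Gamma (p * k)) *
        generalizedBessel (2 * p) k (ρ : ℂ) y) := by
  have hp0 : (0 : ℝ) < p := by positivity
  have hkpos : 0 < k := by
    by_contra h
    have := mul_nonpos_of_nonneg_of_nonpos hp0.le (not_lt.1 h)
    linarith
  set s := (p : ℝ) * k - 1 / 2 with hs
  have hspos : 0 < s := by linarith
  have hcast : ((p - 1 : ℕ) : ℝ) + 1 = p := by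
    have : p - 1 + 1 = p := by omega
    exact_mod_cast this
  set η := (Complex.exp (2 * Real.pi * Complex.I / (2 * p : ℕ)))⁻¹ with hη
  have hηprim : IsPrimitiveRoot η (2 * p) := (Complex.isPrimitiveRoot_exp (2 * p) (by omega)).inv
  set a : Fin (p - 1 + 1) → ℝ := fun i => (ρ * inner ℝ (η ^ (i : ℕ)) y) ^ 2 with ha
  have ha0 : ∀ i, 0 ≤ a i := fun i => sq_nonneg _
  have hinner : ∀ᵐ u : Fin (p - 1) → ℝ, ∫⁻ z, ENNReal.ofReal (laplaceDensity p k ρ y (z, u)) =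
      ∑' m : ℕ, ENNReal.ofReal (Real.pi / s / (4 ^ m * m.factorial * poch (s + 1) m)) *
        ((∏ i, posPow k (baryCoord 1 u i)) *
          ENNReal.ofReal ((∑ i, a i * baryCoord 1 u i) ^ m)) := by
    filter_upwards [ae_baryCoord_ne_zero (q := p - 1) (by omega)] with u hu
    rw [lintegral_congr fun z => ofReal_laplaceDensity hp k ρ y z hu,
      lintegral_mul_const _ (by fun_prop)]
    by_cases hpos : ∀ i, 0 < baryCoord 1 u i
    · rw [lintegral_exp_mul_posPow_ellipse hspos (coeffA_pos hp hpos) (coeffC_pos hp hpos) hρ,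
        quadraticForm_eq_sum hp hpos, ← ENNReal.tsum_mul_right]
      congr 1
      funext m
      have hpo := poch_pos (show 0 < s + 1 by linarith) m
      rw [show Real.pi / s * ((∑ i : Fin (p - 1 + 1), (ρ * inner ℝ (η ^ (i : ℕ)) y) ^ 2 *
          baryCoord 1 u i) ^ m / (4 ^ m * m.factorial * poch (s + 1) m)) =
          Real.pi / s / (4 ^ m * m.factorial * poch (s + 1) m) *
            (∑ i, a i * baryCoord 1 u i) ^ m by ring, ENNReal.ofReal_mul (by positivity)]
      ring
    · push Not at hpos
      obtain ⟨i, hi⟩ := hpos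
      rw [Finset.prod_eq_zero (Finset.mem_univ i) (posPow_of_nonpos k hi)]
      simp
  have hD := hasSum_generalizedBessel (show 0 < p by omega) hkpos ρ y hηprim
  have hcoef : ∀ m, PowerSeries.coeff m (∏ j ∈ Finset.range p,
      negBinomial k ((ρ * inner ℝ (η ^ j) y) ^ 2)) =
      PowerSeries.coeff m (∏ i, negBinomial k (a i)) := by
    intro m
    rw [show Finset.range p = Finset.range (p - 1 + 1) by congr 1; omega, Finset.prod_range]
  simp_rw [hcoef] at hD
  have hG1 := Real.Gamma_pos_of_pos hkpos
  have hpk : 0 < (p : ℝ) * k := by positivity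
  have hG2 := Real.Gamma_pos_of_pos hpk
  have hcoef0 := coeff_prod_negBinomial_nonneg hkpos.le Finset.univ (a := a) fun i _ => ha0 i
  rw [Measure.volume_eq_prod, lintegral_prod_symm' _ (measurable_laplaceDensity p k ρ y).ennreal_ofReal,
    lintegral_congr_ae hinner, lintegral_tsum fun m => by fun_prop, ← hD.tsum_eq, ← tsum_mul_left,
    ENNReal.ofReal_tsum_of_nonneg _ (hD.summable.mul_left _)]
  · congr 1
    funext m
    have hpo := poch_pos (show 0 < s + 1 by linarith) m
    have hpo2 := poch_pos hpk m
    rw [lintegral_const_mul _ (by fun_prop), lintegral_prod_posPow_mul_pow hkpos ha0, hcast,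
      ← ENNReal.ofReal_mul (by positivity)]
    congr 1
    rw [mul_assoc 2, poch_two_mul, show (p : ℝ) * k + 1 / 2 = s + 1 by rw [hs]; ring,
      show Real.Gamma k ^ (p - 1 + 1) = Real.Gamma k ^ p by congr 1; omega]
    field_simp
  · intro m
    have := (poch_pos (show 0 < 2 * (p : ℝ) * k by positivity) (2 * m)).le
    have := hcoef0 m
    positivity

end Kernel

end

theorem corollary3 (p : ℕ) (hp : 2 ≤ p) (k : ℝ) (hk : 1 / 2 < (p : ℝ) * k)
    (ρ : ℝ) (hρ : 0 < ρ) (y : ℂ) (hy : y ∈ closedWeylChamber (2 * p)) :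
    (∀ᵐ z : ℂ, IntegrableOn (laplaceIntegrand p k ρ z) (laplaceRegion p ρ z)) ∧
    Integrable (fun z : ℂ => Real.exp (inner ℝ y z) * laplaceKernel p k ρ z) ∧
    generalizedBessel (2 * p) k (ρ : ℂ) y =
      ∫ z : ℂ, Real.exp (inner ℝ y z) * laplaceKernel p k ρ z := by
  have hp0 : (0 : ℝ) < p := by positivity
  have hkpos : 0 < k := by
    by_contra h
    have := mul_nonpos_of_nonneg_of_nonpos hp0.le (not_lt.1 h)
    linarith
  have hpk : 0 < (p : ℝ) * k := by positivity
  have hs : 0 < (p : ℝ) * k - 1 / 2 := by linarith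
  have hG1 := Real.Gamma_pos_of_pos hkpos
  have hG2 := Real.Gamma_pos_of_pos hpk
  have hmass := lintegral_laplaceDensity hp hk hρ y
  have hmeas := measurable_laplaceDensity p k ρ y
  have hnonneg := laplaceDensity_nonneg p k ρ y
  have hint : Integrable (laplaceDensity p k ρ y) (volume.prod volume) := by
    refine ⟨hmeas.aestronglyMeasurable, ?_⟩
    rw [hasFiniteIntegral_iff_ofReal (Filter.Eventually.of_forall hnonneg), ← Measure.volume_eq_prod,
      hmass]
    exact ENNReal.ofReal_lt_top
  have hDnonneg := generalizedBessel_nonneg (show 0 < p by omega) hkpos ρ y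
  have hval : ∫ x, laplaceDensity p k ρ y x ∂(volume.prod volume) =
      Real.pi / (p * k - 1 / 2) * (Real.Gamma k ^ p / Real.Gamma (p * k)) *
        generalizedBessel (2 * p) k (ρ : ℂ) y := by
    rw [integral_eq_lintegral_of_nonneg_ae (Filter.Eventually.of_forall hnonneg)
      hmeas.aestronglyMeasurable, ← Measure.volume_eq_prod, hmass, ENNReal.toReal_ofReal]
    positivity
  set P := ((p : ℝ) * k - 1 / 2) / Real.pi * (besselConstant (2 * p) k * Real.Gamma (p * k) /
    (2 * p * ProbabilityTheory.beta (k + 1 / 2) (1 / 2) * Real.Gamma (2 * p * k) *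
      Real.Gamma k ^ p)) with hP
  have hPval : P * (Real.pi / (p * k - 1 / 2) * (Real.Gamma k ^ p / Real.Gamma (p * k))) = 1 := by
    have hG3 := Real.Gamma_pos_of_pos (show 0 < 2 * (p : ℝ) * k by positivity)
    have hB := ProbabilityTheory.beta_pos (show 0 < k + 1 / 2 by positivity) (one_half_pos (α := ℝ))
    have h1 : besselConstant (2 * p) k =
        ProbabilityTheory.beta (k + 1 / 2) (1 / 2) * (2 * p * Real.Gamma (2 * p * k)) := by
      unfold besselConstant
      push_cast
      rw [Real.Gamma_add_one (by positivity)]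
      field_simp
    rw [hP, h1]
    generalize (p : ℝ) * k - 1 / 2 = s at hs
    generalize ProbabilityTheory.beta (k + 1 / 2) (1 / 2) = B at hB
    field_simp
  have hkernel : ∀ z, Real.exp (inner ℝ y z) * laplaceKernel p k ρ z =
      P * ∫ u, laplaceDensity p k ρ y (z, u) := by
    intro z
    have h1 : ∀ u, laplaceDensity p k ρ y (z, u) = Real.exp (inner ℝ y z) *
      (laplaceRegion p ρ z).indicator (laplaceIntegrand p k ρ z) u := fun _ => rfl
    simp_rw [h1]
    unfold laplaceKernel
    rw [integral_const_mul, integral_indicator (measurableSet_laplaceRegion p ρ z), ← hP]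
    ring
  refine ⟨?_, ?_, ?_⟩
  · filter_upwards [hint.prod_right_ae] with z hz
    rw [← integrable_indicator_iff (measurableSet_laplaceRegion p ρ z)]
    refine (hz.const_mul (Real.exp (inner ℝ y z))⁻¹).congr (Filter.Eventually.of_forall fun u => ?_)
    unfold laplaceDensity
    exact inv_mul_cancel_left₀ (Real.exp_pos _).ne' _
  · simp_rw [hkernel]
    exact hint.integral_prod_left.const_mul P
  · simp_rw [hkernel]
    rw [integral_const_mul, ← integral_prod _ hint, hval, ← mul_assoc, hPval, one_mul]
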